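/- Let $\ell\ge 0$, let $Q=\bigoplus_{i=1}^{\ell}\mathbb{Z}v_i$ be the lattice with $(v_i|v_j)=\delta_{ij}$, let $\mathfrak{h}=\mathbb{C}\otimes_{\mathbb{Z}}Q$ with the form extended bilinearly, and let $\varepsilon:Q\times Q\to\{\pm1\}$ be the bimultiplicative function with $\varepsilon(v_i,v_j)=\epsilon_{ij}$, where $\epsilon_{ij}=1$ for $i<j$ and $\epsilon_{ij}=-1$ for $i\ge j$. Let $S$ be the symmetric algebra of $\bigoplus_{n<0}\mathfrak{h}s^n$ and let $V_Q=S\otimes\mathbb{C}_\varepsilon[Q]$ be the lattice vertex algebra of $Q$, where $\mathbb{C}_\varepsilon[Q]$ is the twisted group algebra with basis $e^\beta$ ($\beta\in Q$). Its vacuum is $|0\rangle=1\otimes e^0$. For $h\in\mathfrak h$ the operator $h_{(n)}$ on $V_Q$ is multiplication by $hs^{n}$ if $n<0$; it acts on $S\otimes e^\beta$ as the scalar $(h|\beta)$ if $n=0$; and it is the derivation of $S$ with $g s^{-k}\mapsto\delta_{n,k}\,n\,(h|g)$ (for $g\in\mathfrak h$, $k>0$) if $n>0$. Further $e^\alpha(g\otimes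 e^\beta)=\varepsilon(\alpha,\beta)\,g\otimes e^{\alpha+\beta}$, and, with $h(z)=\sum_{m\in\mathbb Z}h_{(-m)}z^{m-1}$ and $$E^\alpha(z)=e^\alpha z^{\alpha_{(0)}}\exp\Big(\sum_{n>0}\alpha_{(-n)}\frac{z^n}{n}\Big)\exp\Big(\sum_{n<0}\alpha_{(-n)}\frac{z^n}{n}\Big),$$ the state-field correspondence is the linear map given by $$Y(h_1s^{-m_1-1}\cdots h_ks^{-m_k-1}\otimes e^\alpha,z)=\frac{1}{m_1!\cdots m_k!}:\partial_z^{m_1}h_1(z)\cdots\partial_z^{m_k}h_k(z)\,E^\alpha(z):\qquad(m_j\ge 0),$$ where the normally ordered product is expanded from right to left by $:A(z)B(z):\,=A(z)_{\ge0}B(z)+B(z)A(z)_{<0}$. Here $A(z)_{\ge 0}$ and $A(z)_{<0}$ are the parts of $A(z)$ with the nonnegative and with the negative powers of $z$. Write $Y(a,z)=\sum_{m\in\mathbb Z}a_{(m)}z^{-m-1}$ for $a\in V_Q$. Identify $h\in\mathfrak h$ with $h_{(-1)}|0\rangle$, put $e_{kl}=\epsilon_{lk}\,(1\otimes e^{v_k-v_l})$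 for $k\ne l$, and let $$\mathring{\mathfrak g}=\bigoplus_{i=1}^{\ell-1}\mathbb{C}(v_i-v_{i+1})\oplus\bigoplus_{k\neq l}\mathbb{C}e_{kl}\subset V_Q,\qquad [a,b]=a_{(0)}b .$$ Let $\rho:\mathring{\mathfrak g}\to\mathfrak{sl}_\ell(\mathbb C)$ be the linear isomorphism with $\rho(v_i-v_{i+1})=E_{i,i}-E_{i+1,i+1}$ and $\rho(e_{kl})=E_{k,l}$, and put $(a|b)=\operatorname{tr}(\rho(a)\rho(b))$ for $a,b\in\mathring{\mathfrak g}$. **Proposition.** For all $a,b\in\mathring{\mathfrak g}$ and $m,n\in\mathbb{Z}$, $$[a_{(m)},b_{(n)}]=[a,b]_{(m+n)}+\delta_{m,-n}\,m\,(a|b)\,\mathrm{Id}_{V_Q}.$$ Consequently, let $\mathcal L(\mathfrak{sl}_\ell)=\mathfrak{sl}_\ell[s,s^{-1}]\oplus\mathbb{C}K$ be the affine Lie algebra with bracket $$[Xs^m+\lambda K,\,Ys^n+\mu K]=[X,Y]s^{m+n}+\delta_{m,-n}\,m\operatorname{tr}(XY)K .$$ There is an injective Lie algebra homomorphism $\mathcal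 L(\mathfrak{sl}_\ell)\to\operatorname{End}(V_Q)$ that sends $\rho(a)s^m$ to $a_{(m)}$ for all $a\in\mathring{\mathfrak g}$ and $m\in\mathbb Z$ and sends $K$ to $\mathrm{Id}_{V_Q}$ (level $1$). Its image is the linear span of $\mathrm{Id}_{V_Q}$ and all the modes $a_{(m)}$ with $a\in\mathring{\mathfrak g}$, $m\in\mathbb{Z}$. -/

import Mathlib

attribute [local instance 100] LieRing.ofAssociativeRing

namespace LatticeVA

open scoped TensorProduct

noncomputable section

/-- The lattice `Q = ⊕ ℤ v_i` of rank `ℓ`, in coordinates with respect to `v_1, …, v_ℓ`. -/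
abbrev Lat (ℓ : ℕ) : Type := Fin ℓ → ℤ

/-- The complexification `𝔥 = ℂ ⊗ Q`, in coordinates with respect to `v_1, …, v_ℓ`. -/
abbrev Cartan (ℓ : ℕ) : Type := Fin ℓ → ℂ

/-- The bilinear form on `Q` with `(v_i | v_j) = δ_{ij}`. -/
def latForm {ℓ : ℕ} (α β : Lat ℓ) : ℤ := ∑ i, α i * β i

/-- The inclusion `Q ⊂ 𝔥`. -/
def toCartan {ℓ : ℕ} (α : Lat ℓ) : Cartan ℓ := fun i => (α i : ℂ)

/-- The basis vector `v_i` of `Q`. -/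
def v {ℓ : ℕ} (i : Fin ℓ) : Lat ℓ := Pi.single i 1

/-- The signs `ε_{ij}`: `1` for `i < j` and `-1` for `i ≥ j`. -/
def epsSign {ℓ : ℕ} (i j : Fin ℓ) : ℤˣ := if i < j then 1 else -1

/-- The bimultiplicative function `ε : Q × Q → {±1}` with `ε(v_i, v_j) = ε_{ij}`. -/
def eps {ℓ : ℕ} (α β : Lat ℓ) : ℤˣ := ∏ i, ∏ j, epsSign i j ^ (α i * β j)

/-- The symmetric algebra `S` of `𝔥^{<0} = ⊕_{j < 0} 𝔥 s^j`, as the polynomial algebra on the basis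
of `𝔥^{<0}`: the variable `(i, n)` is `v_i s^{-(n+1)}`. -/
abbrev Sym (ℓ : ℕ) : Type := MvPolynomial (Fin ℓ × ℕ) ℂ

/-- The space of states `V_Q = S ⊗ ℂ_ε[Q]`: the vector `g ⊗ e^β` is `Finsupp.single β g`. -/
abbrev Space (ℓ : ℕ) : Type := Lat ℓ →₀ Sym ℓ

/-- The vector `1 ⊗ e^α`. -/
def expVec {ℓ : ℕ} (α : Lat ℓ) : Space ℓ := Finsupp.single α 1

/-- The vacuum vector `1 ⊗ e^0`. -/
def vac (ℓ : ℕ) : Space ℓ := expVec 0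

/-- The action of `e^α`: `e^α (g ⊗ e^β) = ε(α, β) g ⊗ e^{α + β}`. -/
def expOp {ℓ : ℕ} (α : Lat ℓ) : Module.End ℂ (Space ℓ) :=
  Finsupp.lsum ℂ fun β => (((eps α β : ℤˣ) : ℤ) : ℂ) • Finsupp.lsingle (α + β)

/-- The action of an endomorphism of `S` on the left factor of `S ⊗ ℂ_ε[Q]`. -/
def onSym {ℓ : ℕ} (f : Module.End ℂ (Sym ℓ)) : Module.End ℂ (Space ℓ) :=
  Finsupp.mapRange.linearMap f

/-- The Heisenberg operator `h_{(n)}` for `h ∈ 𝔥`: multiplication by `h s^n` for `n < 0`, the scalar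
`(h | β)` on `S ⊗ e^β` for `n = 0`, and for `n > 0` the derivation of `S` with
`g s^{-k} ↦ δ_{n,k} n (h | g)`. -/
def heis {ℓ : ℕ} (h : Cartan ℓ) : ℤ → Module.End ℂ (Space ℓ)
  | Int.negSucc k => onSym (∑ i, h i • LinearMap.mulLeft ℂ (MvPolynomial.X (i, k) : Sym ℓ))
  | Int.ofNat 0 => Finsupp.lsum ℂ fun β => (∑ i, h i * (β i : ℂ)) • Finsupp.lsingle β
  | Int.ofNat (k + 1) =>
      onSym (((k : ℂ) + 1) • ∑ i, h i • (MvPolynomial.pderiv (R := ℂ) (i, k)).toLinearMap)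

/-! ### Formal distributions -/

/-- `End(V_Q)[[z, z⁻¹]]`: the value at `n` is the coefficient of `z^n`. -/
abbrev Distr (ℓ : ℕ) : Type := ℤ → Module.End ℂ (Space ℓ)

open Classical in
/-- The sum of a family of endomorphisms only finitely many of which are nonzero on each vector
(and `0` for all other families, for which the sum has no meaning). -/
def locSum {ι V : Type*} [AddCommGroup V] [Module ℂ V] (f : ι → Module.End ℂ V) :
    Module.End ℂ V :=
  if hf : ∀ x, (Function.support fun i => f i x).Finite then
    { toFun := fun x => ∑ᶠ i, f i x
      map_add' := fun x y => by
        simp only [map_add]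
        exact finsum_add_distrib (hf x) (hf y)
      map_smul' := fun c x => by
        simp only [map_smul, RingHom.id_apply]
        exact (smul_finsum' c (hf x)).symm }
  else 0

/-- The product of formal distributions. -/
def mulD {ℓ : ℕ} (A B : Distr ℓ) : Distr ℓ := fun n => locSum fun k : ℤ => A k * B (n - k)

/-- The derivative `∂_z`. -/
def derivD {ℓ : ℕ} (A : Distr ℓ) : Distr ℓ := fun n => ((n : ℂ) + 1) • A (n + 1)

/-- The part `A(z)_{≥0}`. -/
def nonnegD {ℓ : ℕ} (A : Distr ℓ) : Distr ℓ := fun n => if 0 ≤ n then A n else 0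

/-- The part `A(z)_{<0}`. -/
def negD {ℓ : ℕ} (A : Distr ℓ) : Distr ℓ := fun n => if n < 0 then A n else 0

/-- The normally ordered product `:A(z) B(z): = A(z)_{≥0} B(z) + B(z) A(z)_{<0}`. -/
def normalOrd {ℓ : ℕ} (A B : Distr ℓ) : Distr ℓ := mulD (nonnegD A) B + mulD B (negD A)

/-- The exponential of a power series with vanishing constant term; as `f ^ j` has no terms of degree
less than `j`, the sum stops at `j = n` in degree `n`. -/
def expSeries {A : Type*} [Ring A] [Algebra ℂ A] (f : PowerSeries A) : PowerSeries A :=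
  PowerSeries.mk fun n =>
    ∑ j ∈ Finset.range (n + 1), ((j.factorial : ℂ)⁻¹) • PowerSeries.coeff n (f ^ j)

/-- The current `h(z) = ∑_m h_{(-m)} z^{m-1}`. -/
def current {ℓ : ℕ} (h : Cartan ℓ) : Distr ℓ := fun n => heis h (-n - 1)

/-- `exp (∑_{n>0} α_{(-n)} z^n / n)`. -/
def expCreate {ℓ : ℕ} (α : Lat ℓ) : Distr ℓ := fun n =>
  if 0 ≤ n then
    PowerSeries.coeff n.toNat (expSeries (PowerSeries.mk fun k : ℕ =>
      if k = 0 then 0 else ((k : ℂ)⁻¹) • heis (toCartan α) (-(k : ℤ))))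
  else 0

/-- `exp (∑_{n<0} α_{(-n)} z^n / n)`, a power series in `z⁻¹`. -/
def expAnnih {ℓ : ℕ} (α : Lat ℓ) : Distr ℓ := fun n =>
  if n ≤ 0 then
    PowerSeries.coeff (-n).toNat (expSeries (PowerSeries.mk fun k : ℕ =>
      if k = 0 then 0 else (-(k : ℂ)⁻¹) • heis (toCartan α) (k : ℤ)))
  else 0

/-- `z^{α_{(0)}}`, which multiplies `g ⊗ e^β` by `z^{(α|β)}`. -/
def zPow {ℓ : ℕ} (α : Lat ℓ) : Distr ℓ := fun n =>
  Finsupp.lsum ℂ fun β => if latForm α β = n then Finsupp.lsingle β else 0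

/-- The vertex operator `E^α(z)`. -/
def vertexOp {ℓ : ℕ} (α : Lat ℓ) : Distr ℓ := fun n =>
  expOp α * mulD (zPow α) (mulD (expCreate α) (expAnnih α)) n

/-- The field of `v_{i_1} s^{-m_1-1} ⋯ v_{i_k} s^{-m_k-1} ⊗ e^α`, the factors being listed in `L`:
the normally ordered product of `∂_z^{m_j} v_{i_j}(z) / m_j!` and `E^α(z)`, expanded from the right
to the left. -/
def monomialField {ℓ : ℕ} (α : Lat ℓ) (L : List (Fin ℓ × ℕ)) : Distr ℓ :=
  L.foldr (fun p A =>
    normalOrd (((p.2.factorial : ℂ)⁻¹) • derivD^[p.2] (current (toCartan (v p.1)))) A)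
    (vertexOp α)

/-- The state-field correspondence `Y(·, z) : V_Q → End(V_Q)[[z, z⁻¹]]`, given on the basis of
monomials. The order in which the factors of a monomial are listed does not matter, since creation
operators commute with each other and so do annihilation operators. -/
def Y {ℓ : ℕ} : Space ℓ →ₗ[ℂ] Distr ℓ :=
  Finsupp.lsum ℂ fun α => (MvPolynomial.basisMonomials (Fin ℓ × ℕ) ℂ).constr ℂ fun d =>
    monomialField α (Finsupp.toMultiset d).toList

/-- The mode `a_{(m)}` in `Y(a, z) = ∑_m a_{(m)} z^{-m-1}`. -/
def mode {ℓ : ℕ} (a : Space ℓ) (m : ℤ) : Module.End ℂ (Space ℓ) := Y a (-m - 1)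

/-! ### The subspace of `V_Q` identified with `𝔰𝔩_ℓ` -/

/-- The state `h_{(-1)} |0⟩`, also denoted `h`. -/
def cartanState {ℓ : ℕ} (h : Cartan ℓ) : Space ℓ := heis h (-1) (vac ℓ)

/-- The state `e_{kl} = ε_{lk} e^{v_k - v_l}`. -/
def eState {ℓ : ℕ} (k l : Fin ℓ) : Space ℓ :=
  (((epsSign l k : ℤˣ) : ℤ) : ℂ) • expVec (v k - v l)

/-- The subspace `⊕ ℂ (v_i - v_{i+1}) ⊕ ⊕_{k ≠ l} ℂ e_{kl}` of `V_Q`. -/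
def slSpace (ℓ : ℕ) : Submodule ℂ (Space ℓ) :=
  Submodule.span ℂ
    ({x | ∃ i j : Fin ℓ, (i : ℕ) + 1 = j ∧ x = cartanState (toCartan (v i - v j))} ∪
     {x | ∃ k l : Fin ℓ, k ≠ l ∧ x = eState k l})

/-- The product `[a, b] = a_{(0)} b`. -/
def stateBracket {ℓ : ℕ} (a b : Space ℓ) : Space ℓ := mode a 0 b

/-- The linear map `V_Q → Mat_ℓ(ℂ)` reading off coefficients: off the diagonal, `ε_{lk}` times that of
`1 ⊗ e^{v_k - v_l}`; on the diagonal, that of `v_i s^{-1} ⊗ e^0`. -/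
def coeffMatrix (ℓ : ℕ) : Space ℓ →ₗ[ℂ] Matrix (Fin ℓ) (Fin ℓ) ℂ where
  toFun a := Matrix.of fun k l =>
    if k = l then MvPolynomial.coeff (Finsupp.single (k, 0) 1) (a 0)
    else (((epsSign l k : ℤˣ) : ℤ) : ℂ) * MvPolynomial.coeff 0 (a (v k - v l))
  map_add' a b := by
    ext k l
    by_cases h : k = l <;> simp [h, mul_add]
  map_smul' c a := by
    ext k l
    by_cases h : k = l <;> simp [h, mul_left_comm]

lemma cartanState_eq {ℓ : ℕ} (h : Cartan ℓ) :
    cartanState h = Finsupp.single 0 (∑ i, h i • (MvPolynomial.X (i, 0) : Sym ℓ)) := by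
  change heis h (Int.negSucc 0) (vac ℓ) = _
  simp [heis, onSym, vac, expVec]

lemma v_sub_v_ne_zero {ℓ : ℕ} {k l : Fin ℓ} (h : k ≠ l) : v k - v l ≠ 0 := by
  intro h0
  have := congrFun h0 k
  simp [v, h] at this

lemma v_sub_v_inj {ℓ : ℕ} {k l k' l' : Fin ℓ} (h : k ≠ l)
    (e : v k - v l = v k' - v l') : k = k' ∧ l = l' := by
  have h1 := congrFun e k
  have h2 := congrFun e l
  simp only [v, Pi.sub_apply, Pi.single_apply] at h1 h2
  grind

lemma coeffMatrix_cartanState {ℓ : ℕ} (h : Cartan ℓ) :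
    coeffMatrix ℓ (cartanState h) = Matrix.diagonal h := by
  classical
  ext k l
  by_cases hkl : k = l
  · subst hkl
    simp [coeffMatrix, cartanState_eq, MvPolynomial.coeff_X, MvPolynomial.coeff_sum,
      Finsupp.single_left_inj]
  · simp [coeffMatrix, cartanState_eq, hkl, (v_sub_v_ne_zero hkl)]

lemma coeffMatrix_eState {ℓ : ℕ} {k l : Fin ℓ} (h : k ≠ l) :
    coeffMatrix ℓ (eState k l) = Matrix.single k l 1 := by
  classical
  have hs : (((epsSign l k : ℤˣ) : ℤ) : ℂ) * (((epsSign l k : ℤˣ) : ℤ) : ℂ) = 1 := by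
    unfold epsSign; split_ifs <;> simp
  ext p q
  by_cases hpq : p = q
  · subst hpq
    have : ¬ (k = p ∧ l = p) := by grind
    simp [coeffMatrix, eState, expVec, this, v_sub_v_ne_zero h]
  · by_cases hc : k = p ∧ l = q
    · obtain ⟨rfl, rfl⟩ := hc
      simp [coeffMatrix, eState, expVec, h, hs]
    · have hne : v k - v l ≠ v p - v q := fun e => hc (v_sub_v_inj h e)
      simp [coeffMatrix, eState, expVec, hc, hpq, Finsupp.single_apply, hne]

/-- The inverse construction: the state with a given coefficient matrix. -/
def matrixState (ℓ : ℕ) : Matrix (Fin ℓ) (Fin ℓ) ℂ →ₗ[ℂ] Space ℓ where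
  toFun X := cartanState X.diag + ∑ k, ∑ l, if k = l then 0 else X k l • eState k l
  map_add' X Z := by
    simp only [cartanState_eq, Matrix.diag_apply, Matrix.add_apply, add_smul, Finset.sum_add_distrib,
      Finsupp.single_add]
    have : ∀ k l : Fin ℓ, (if k = l then (0 : Space ℓ) else X k l • eState k l + Z k l • eState k l)
        = (if k = l then 0 else X k l • eState k l) + (if k = l then 0 else Z k l • eState k l) := by
      intro k l; split_ifs <;> simp
    simp only [this, Finset.sum_add_distrib]
    abel
  map_smul' c X := by
    simp only [cartanState_eq, Matrix.diag_apply, Matrix.smul_apply, smul_eq_mul, mul_smul,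
      RingHom.id_apply, smul_add, Finset.smul_sum, smul_ite, smul_zero, Finsupp.smul_single]

lemma matrixState_diagonal {ℓ : ℕ} (h : Cartan ℓ) :
    matrixState ℓ (Matrix.diagonal h) = cartanState h := by
  change cartanState (Matrix.diag (Matrix.diagonal h)) + _ = _
  rw [Matrix.diag_diagonal, Finset.sum_eq_zero, add_zero]
  intro k _
  refine Finset.sum_eq_zero fun l _ => ?_
  split_ifs with hkl
  · rfl
  · simp [hkl]

lemma matrixState_single {ℓ : ℕ} {k l : Fin ℓ} (h : k ≠ l) :
    matrixState ℓ (Matrix.single k l 1) = eState k l := by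
  change cartanState (Matrix.diag (Matrix.single k l 1)) + _ = _
  have hd : Matrix.diag (Matrix.single k l (1 : ℂ)) = 0 := by
    ext i
    simp only [Matrix.diag_apply, Matrix.single_apply, Pi.zero_apply]
    grind
  have h0 : cartanState (0 : Cartan ℓ) = 0 := by simp [cartanState_eq]
  rw [hd, h0, zero_add, Finset.sum_eq_single k, Finset.sum_eq_single l]
  · simp [h]
  · intro b _ hb
    simp [hb.symm]
  · simp
  · intro b _ hb
    refine Finset.sum_eq_zero fun l' _ => ?_
    simp [hb.symm]
  · simp

lemma coeffMatrix_matrixState {ℓ : ℕ} (X : Matrix (Fin ℓ) (Fin ℓ) ℂ) :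
    coeffMatrix ℓ (matrixState ℓ X) = X := by
  change coeffMatrix ℓ (cartanState X.diag + ∑ k, ∑ l, if k = l then 0 else X k l • eState k l) = X
  rw [map_add, coeffMatrix_cartanState]
  simp only [map_sum]
  have : ∀ k l : Fin ℓ, coeffMatrix ℓ (if k = l then 0 else X k l • eState k l) =
      if k = l then 0 else Matrix.single k l (X k l) := by
    intro k l
    split_ifs with h
    · simp
    · rw [map_smul, coeffMatrix_eState h]; simp
  simp only [this]
  ext p q
  simp only [Matrix.add_apply, Matrix.sum_apply, Matrix.diagonal_apply, Matrix.diag_apply]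
  rw [Finset.sum_eq_single p, Finset.sum_eq_single q]
  · by_cases h : p = q <;> simp [h]
  · intro b _ hb
    split_ifs <;> simp [hb]
  · simp
  · intro b _ hb
    refine Finset.sum_eq_zero fun l' _ => ?_
    split_ifs <;> simp [hb]
  · simp

lemma matrixState_coeffMatrix {ℓ : ℕ} {a : Space ℓ} (ha : a ∈ slSpace ℓ) :
    matrixState ℓ (coeffMatrix ℓ a) = a := by
  have := LinearMap.eqOn_span (f := matrixState ℓ ∘ₗ coeffMatrix ℓ) (g := LinearMap.id)
    (s := ({x | ∃ i j : Fin ℓ, (i : ℕ) + 1 = j ∧ x = cartanState (toCartan (v i - v j))} ∪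
     {x | ∃ k l : Fin ℓ, k ≠ l ∧ x = eState k l})) (by
      rintro x (⟨i, j, -, rfl⟩ | ⟨k, l, hkl, rfl⟩)
      · simp [coeffMatrix_cartanState, matrixState_diagonal]
      · simp [coeffMatrix_eState hkl, matrixState_single hkl])
  exact this ha

lemma coeffMatrix_mem_sl {ℓ : ℕ} {a : Space ℓ} (ha : a ∈ slSpace ℓ) :
    coeffMatrix ℓ a ∈ LieAlgebra.SpecialLinear.sl (Fin ℓ) ℂ := by
  have hle : slSpace ℓ ≤ (LieAlgebra.SpecialLinear.sl (Fin ℓ) ℂ).toSubmodule.comap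
      (coeffMatrix ℓ) := by
    refine Submodule.span_le.2 ?_
    rintro x (⟨i, j, -, rfl⟩ | ⟨k, l, hkl, rfl⟩)
    · change Matrix.trace (coeffMatrix ℓ _) = 0
      rw [coeffMatrix_cartanState, Matrix.trace_diagonal]
      simp [toCartan, v, Pi.single_apply]
    · change Matrix.trace (coeffMatrix ℓ _) = 0
      rw [coeffMatrix_eState hkl, Matrix.trace_single_eq_of_ne _ _ _ hkl]
  exact hle ha

lemma cartanState_sub_mem {ℓ : ℕ} (z i : Fin ℓ) (hz : (z : ℕ) = 0) :
    cartanState (toCartan (v z - v i)) ∈ slSpace ℓ := by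
  have key : ∀ n (hn : n < ℓ), cartanState (toCartan (v z - v ⟨n, hn⟩)) ∈ slSpace ℓ := by
    intro n
    induction n with
    | zero =>
      intro hn
      have : z = ⟨0, hn⟩ := Fin.ext hz
      rw [← this, sub_self]
      simp [cartanState_eq, toCartan]
    | succ n ih =>
      intro hn
      have h1 := ih (by omega)
      have h2 : cartanState (toCartan (v ⟨n, by omega⟩ - v ⟨n + 1, hn⟩)) ∈ slSpace ℓ :=
        Submodule.subset_span (Or.inl ⟨_, _, rfl, rfl⟩)
      have h3 := add_mem h1 h2
      rw [← matrixState_diagonal, ← matrixState_diagonal, ← map_add, Matrix.diagonal_add] at h3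
      rw [← matrixState_diagonal]
      have he : Matrix.diagonal (toCartan (v z - v (⟨n + 1, hn⟩ : Fin ℓ))) =
          Matrix.diagonal fun i => toCartan (v z - v (⟨n, by omega⟩ : Fin ℓ)) i +
            toCartan (v (⟨n, by omega⟩ : Fin ℓ) - v ⟨n + 1, hn⟩) i := by
        refine congrArg Matrix.diagonal (funext fun j => ?_)
        simp [toCartan]
      rw [he]
      exact h3
  exact key i i.2

lemma matrixState_mem {ℓ : ℕ} {X : Matrix (Fin ℓ) (Fin ℓ) ℂ} (hX : X.trace = 0) :
    matrixState ℓ X ∈ slSpace ℓ := by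
  change cartanState X.diag + ∑ k, ∑ l, (if k = l then 0 else X k l • eState k l) ∈ slSpace ℓ
  refine add_mem ?_ (sum_mem fun k _ => sum_mem fun l _ => ?_)
  · rcases Nat.eq_zero_or_pos ℓ with h0 | h0
    · subst h0
      simp [cartanState_eq]
    · have hd : cartanState X.diag =
          ∑ i, (-X i i) • cartanState (toCartan (v (⟨0, h0⟩ : Fin ℓ) - v i)) := by
        simp only [← matrixState_diagonal, ← map_smul, ← map_sum]
        refine congrArg (matrixState ℓ) ?_
        ext p q
        simp only [Matrix.sum_apply, Matrix.smul_apply, Matrix.diagonal_apply]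
        by_cases hpq : p = q
        · subst hpq
          simp only [if_true, toCartan, v, Pi.sub_apply, Pi.single_apply, smul_eq_mul, Int.cast_sub,
            mul_sub, Finset.sum_sub_distrib, ← Finset.sum_mul, Finset.sum_neg_distrib]
          have ht : ∑ i, X i i = 0 := hX
          simp [ht]
        · simp [hpq]
      rw [hd]
      exact sum_mem fun i _ => Submodule.smul_mem _ _ (cartanState_sub_mem _ _ rfl)
  · split_ifs with h
    · exact zero_mem _
    · exact Submodule.smul_mem _ _ (Submodule.subset_span (Or.inr ⟨k, l, h, rfl⟩))

/-- The linear isomorphism `ρ` onto `𝔰𝔩_ℓ` with `ρ(v_i - v_{i+1}) = E_{i,i} - E_{i+1,i+1}` and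
`ρ(e_{kl}) = E_{k,l}`. -/
def rho (ℓ : ℕ) : slSpace ℓ ≃ₗ[ℂ] LieAlgebra.SpecialLinear.sl (Fin ℓ) ℂ where
  toFun a := ⟨coeffMatrix ℓ a, coeffMatrix_mem_sl a.2⟩
  map_add' a b := Subtype.ext (map_add (coeffMatrix ℓ) (a : Space ℓ) b)
  map_smul' c a := Subtype.ext (map_smul (coeffMatrix ℓ) c (a : Space ℓ))
  invFun X := ⟨matrixState ℓ X, matrixState_mem X.2⟩
  left_inv a := Subtype.ext (matrixState_coeffMatrix a.2)
  right_inv X := Subtype.ext (coeffMatrix_matrixState X.1)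

lemma rho_cartan {ℓ : ℕ} (i j : Fin ℓ)
    (h : cartanState (toCartan (v i - v j)) ∈ slSpace ℓ) :
    (rho ℓ ⟨_, h⟩ : Matrix (Fin ℓ) (Fin ℓ) ℂ) = Matrix.single i i 1 - Matrix.single j j 1 := by
  change coeffMatrix ℓ _ = _
  rw [coeffMatrix_cartanState, ← Matrix.diagonal_single, ← Matrix.diagonal_single,
    Matrix.diagonal_sub]
  refine congrArg Matrix.diagonal ?_
  ext p
  simp [toCartan, v, Pi.single_apply]

lemma rho_e {ℓ : ℕ} {k l : Fin ℓ} (hkl : k ≠ l) (h : eState k l ∈ slSpace ℓ) :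
    (rho ℓ ⟨_, h⟩ : Matrix (Fin ℓ) (Fin ℓ) ℂ) = Matrix.single k l 1 :=
  coeffMatrix_eState hkl

/-- The bilinear form `(a | b) = tr (ρ(a) ρ(b))`. -/
def slForm {ℓ : ℕ} (a b : slSpace ℓ) : ℂ :=
  Matrix.trace ((rho ℓ a : Matrix (Fin ℓ) (Fin ℓ) ℂ) * (rho ℓ b : Matrix (Fin ℓ) (Fin ℓ) ℂ))

/-! ### The affine Lie algebra `𝔰𝔩_ℓ[s, s⁻¹] ⊕ ℂ K` -/

/-- The Lie algebra `𝔰𝔩_ℓ`. -/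
abbrev Sl (ℓ : ℕ) : Type := LieAlgebra.SpecialLinear.sl (Fin ℓ) ℂ

/-- The form `tr (X Y)` on `𝔰𝔩_ℓ`. -/
def trForm (ℓ : ℕ) : LinearMap.BilinForm ℂ (Sl ℓ) :=
  LinearMap.mk₂ ℂ (fun X Z => Matrix.trace ((X : Matrix (Fin ℓ) (Fin ℓ) ℂ) * (Z : Matrix _ _ ℂ)))
    (fun X X' Z => by simp [add_mul]) (fun c X Z => by simp)
    (fun X Z Z' => by simp [mul_add]) (fun c X Z => by simp)

lemma trForm_isSymm (ℓ : ℕ) : (trForm ℓ).IsSymm :=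
  ⟨fun X Z => by simpa [trForm] using Matrix.trace_mul_comm _ _⟩

lemma trForm_lieInvariant (ℓ : ℕ) : (trForm ℓ).lieInvariant (Sl ℓ) := by
  intro X Z W
  simp only [trForm, LinearMap.mk₂_apply, LieAlgebra.SpecialLinear.sl_bracket, sub_mul, mul_sub,
    Matrix.trace_sub]
  have h1 := Matrix.trace_mul_cycle X.1 Z.1 W.1
  have h2 := Matrix.trace_mul_cycle Z.1 W.1 X.1
  simp only [mul_assoc] at h1 h2 ⊢
  linear_combination -h2

/-- The 2-cocycle `(X s^m, Y s^n) ↦ δ_{m,-n} m tr(X Y)` on the loop algebra. -/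
def affineCocycle (ℓ : ℕ) :
    LieModule.Cohomology.twoCocycle ℂ (LieAlgebra.loopAlgebra ℂ ℤ (Sl ℓ))
      (TrivialLieModule ℂ (LieAlgebra.loopAlgebra ℂ ℤ (Sl ℓ)) ℂ) :=
  (-1 : ℂ) • LieAlgebra.LoopAlgebra.twoCocycleOfBilinear ℂ ℤ (Sl ℓ) (trForm ℓ) (trForm_lieInvariant ℓ)
    (trForm_isSymm ℓ)

/-- The affine Lie algebra `𝓛(𝔰𝔩_ℓ)`, the central extension of the loop algebra of `𝔰𝔩_ℓ` by `ℂ K`. -/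
abbrev AffineSl (ℓ : ℕ) : Type := LieAlgebra.ofTwoCocycle (affineCocycle ℓ)

/-- The element `X s^m` of the affine Lie algebra. -/
def loopElt {ℓ : ℕ} (X : Sl ℓ) (m : ℤ) : AffineSl ℓ :=
  LieAlgebra.ofProd _ (AddMonoidAlgebra.single m (1 : ℂ) ⊗ₜ[ℂ] X, 0)

/-- The central element `K`. -/
def centralElt (ℓ : ℕ) : AffineSl ℓ :=
  LieAlgebra.ofProd _ (0, (TrivialLieModule.equiv ℂ _ ℂ).symm 1)

lemma affineCocycle_apply {ℓ : ℕ} (X Z : Sl ℓ) (m n : ℤ) :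
    (affineCocycle ℓ : LieModule.Cohomology.twoCochain ℂ (LieAlgebra.loopAlgebra ℂ ℤ (Sl ℓ)) _)
      (AddMonoidAlgebra.single m (1 : ℂ) ⊗ₜ[ℂ] X) (AddMonoidAlgebra.single n (1 : ℂ) ⊗ₜ[ℂ] Z) =
    (TrivialLieModule.equiv ℂ (LieAlgebra.loopAlgebra ℂ ℤ (Sl ℓ)) ℂ).symm
      (if m = -n then (m : ℂ) * Matrix.trace (X.1 * Z.1) else 0) := by
  have hc := LieAlgebra.LoopAlgebra.twoCochainOfBilinear_apply_apply ℂ ℤ (Sl ℓ) (trForm ℓ)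
    (trForm_isSymm ℓ) (AddMonoidAlgebra.single m (1 : ℂ) ⊗ₜ[ℂ] X)
    (AddMonoidAlgebra.single n (1 : ℂ) ⊗ₜ[ℂ] Z)
  change (-1 : ℂ) • (LieAlgebra.LoopAlgebra.twoCochainOfBilinear ℂ ℤ (Sl ℓ) (trForm ℓ)
    (trForm_isSymm ℓ)) (AddMonoidAlgebra.single m (1 : ℂ) ⊗ₜ[ℂ] X)
    (AddMonoidAlgebra.single n (1 : ℂ) ⊗ₜ[ℂ] Z) = _
  rw [hc, ← LinearEquiv.map_smul]
  refine congrArg _ ?_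
  simp only [LieAlgebra.LoopAlgebra.residuePairing_apply_apply,
    LieAlgebra.LoopAlgebra.toFinsupp_single_tmul]
  rw [Finsupp.sum_single_index (by simp)]
  by_cases h : m = -n
  · subst h
    simp [trForm]
  · have h' : -n ≠ m := fun e => h e.symm
    simp [h, h']

lemma bracket_affine {ℓ : ℕ} (X Z : Sl ℓ) (m n : ℤ) (c d : ℂ) :
    ⁅loopElt X m + c • centralElt ℓ, loopElt Z n + d • centralElt ℓ⁆ =
      loopElt ⁅X, Z⁆ (m + n) +
        (if m = -n then (m : ℂ) * Matrix.trace ((X : Matrix (Fin ℓ) (Fin ℓ) ℂ) * (Z : Matrix _ _ ℂ))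
          else 0) • centralElt ℓ := by
  rw [LieAlgebra.bracket_ofTwoCocycle]
  unfold loopElt centralElt
  simp only [← LieAlgebra.of_smul, ← LieAlgebra.of_add, Equiv.symm_apply_apply]
  refine congrArg _ (Prod.ext ?_ ?_)
  · simp only [Prod.fst_add, Prod.smul_fst, smul_zero, add_zero,
      LieAlgebra.ExtendScalars.bracket_tmul, AddMonoidAlgebra.single_mul_single, mul_one]
  · simp only [smul_zero, add_zero, zero_add, Prod.snd_add, Prod.smul_snd, trivial_lie_zero,
      sub_zero, Prod.fst_add, Prod.smul_fst]
    refine (affineCocycle_apply X Z m n).trans ?_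
    rw [← LinearEquiv.map_smul, smul_eq_mul, mul_one]

end

end LatticeVA

/-!
The modes of the states in `slSpace ℓ` satisfy the relations of the affine Lie algebra at level one
because of three kinds of commutators: those of Heisenberg operators with each other (`comm_heis`),
those of Heisenberg operators with vertex operators, `[h_{(k)}, E^α(z)] = (h|α) z^k E^α(z)`
(`comm_heis_vertexOp`), and those of two vertex operators `E^α(z)`, `E^β(w)` with `α`, `β` roots.

The last kind is reduced to an identity of scalars. Each candidate `D(z,w)` for the difference of
`[E^α(z), E^β(w)]` and its claimed value satisfies
`[h_{(k)}, D(z,w)] = ((h|α) z^k + (h|β) w^k) D(z,w)`. Hence `D = 0` as soon as `D` kills all vectors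
`1 ⊗ e^γ`, since these generate the space under creation operators; and for this it is enough that
the coefficients of `D(z,w) (1 ⊗ e^γ)` have vanishing constant terms, since their span is stable
under annihilation operators, which act by derivatives (`bilocal_eq_zero`). The constant term of
`E^α(z) E^β(w) (1 ⊗ e^γ)` is, up to sign, a monomial times the expansion of `(1 - w/z)^{(α|β)}` for
`|w| < |z|` (`constCoeff_vertexOp_vertexOp`); it follows from Euler's recursion for the coefficients
of an exponential. So the commutator is governed by the difference of the two expansions of
`(z - w)^{(α|β)}`: it is zero for `(α|β) = 0, 1, 2`, gives `δ(z-w)` for `(α|β) = -1`, and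
`∂_w δ(z-w)` for `(α|β) = -2`. The signs `ε` turn the structure constants into those of matrix units
(`affineRel`); the relations hold for all of `𝔤𝔩_ℓ`. Evaluated on the vacuum they show that
`a_{(0)} b` is the commutator of matrices (`stateBracket_matrixState`).

For injectivity, the vacuum expectation value vanishes on all modes and not on the identity. So the
kernel lies in the loop algebra, and being an ideal it lies in the radical of the cocycle. As the
trace form is nondegenerate, elements of the kernel are concentrated in degree zero; bracketing them
with degree one gives elements of the kernel again, so they are central in `𝔰𝔩_ℓ`, hence zero
(`loopRep_injective`).
-/

namespace LatticeVA

/-! ### Commutators -/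

section Commutator

variable {A : Type*} [Ring A]

/-- The commutator `x y - y x` in a ring. On endomorphisms it agrees with the Lie bracket by
definition; it is used because the bracket of endomorphisms can be read in two ways, as that of the
associative algebra and as the action on a space of linear maps. -/
def comm (x y : A) : A := x * y - y * x

lemma comm_zero (x : A) : comm x 0 = 0 := by simp [comm]

lemma comm_sub (x y z : A) : comm x (y - z) = comm x y - comm x z := by
  simp only [comm, mul_sub, sub_mul]
  abel

lemma comm_add (x y z : A) : comm x (y + z) = comm x y + comm x z := by
  simp only [comm, mul_add, add_mul]
  abel

lemma neg_comm (x y : A) : -comm x y = comm y x := neg_sub _ _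

lemma comm_mul (x y z : A) : comm x (y * z) = comm x y * z + y * comm x z := by
  simp only [comm]
  noncomm_ring

lemma comm_comm (x y z : A) : comm x (comm y z) = comm (comm x y) z + comm y (comm x z) := by
  simp only [comm]
  noncomm_ring

lemma comm_smul [Algebra ℂ A] (c : ℂ) (x y : A) : comm x (c • y) = c • comm x y := by
  simp [comm, smul_sub]

lemma comm_smul_left [Algebra ℂ A] (c : ℂ) (x y : A) :
    comm (c • x) y = c • comm x y := by
  simp [comm, smul_sub]

lemma comm_smul_one [Algebra ℂ A] (c : ℂ) (x : A) :
    comm x (c • (1 : A)) = 0 := by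
  rw [comm_smul]
  simp [comm]

lemma comm_eq_zero {x y : A} : comm x y = 0 ↔ Commute x y := sub_eq_zero

lemma comm_eq_zero_symm {x y : A} (h : comm x y = 0) : comm y x = 0 := by
  rw [← neg_comm, h, neg_zero]

end Commutator

/-! ### Locally finite sums of endomorphisms -/

section LocallyFinite

variable {ι V : Type*} [AddCommGroup V] [Module ℂ V]

/-- A family of endomorphisms only finitely many of which are nonzero on each vector. -/
def LocFin (f : ι → Module.End ℂ V) : Prop := ∀ x, (Function.support fun i => f i x).Finite

lemma locSum_apply {f : ι → Module.End ℂ V} (hf : LocFin f) (x : V) :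
    locSum f x = ∑ᶠ i, f i x := by
  have hf' : ∀ x, (Function.support fun i => f i x).Finite := hf
  unfold locSum
  rw [dif_pos hf']
  rfl

lemma LocFin.mul_left {f : ι → Module.End ℂ V} (hf : LocFin f) (H : Module.End ℂ V) :
    LocFin fun i => H * f i := fun x =>
  (hf x).subset fun _ hi h0 => hi ((congrArg H h0).trans (map_zero H))

lemma LocFin.mul_right {f : ι → Module.End ℂ V} (hf : LocFin f) (H : Module.End ℂ V) :
    LocFin fun i => f i * H := fun x => hf (H x)

lemma mul_locSum {f : ι → Module.End ℂ V} (hf : LocFin f) (H : Module.End ℂ V) :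
    H * locSum f = locSum fun i => H * f i := by
  ext x
  rw [Module.End.mul_apply, locSum_apply hf, locSum_apply (hf.mul_left H)]
  exact H.toAddMonoidHom.map_finsum (hf x)

lemma locSum_mul {f : ι → Module.End ℂ V} (hf : LocFin f) (H : Module.End ℂ V) :
    locSum f * H = locSum fun i => f i * H := by
  ext x
  rw [Module.End.mul_apply, locSum_apply hf, locSum_apply (hf.mul_right H)]
  rfl

lemma locSum_sub {f g : ι → Module.End ℂ V} (hf : LocFin f) (hg : LocFin g) :
    locSum f - locSum g = locSum fun i => f i - g i := by
  have hfg : LocFin fun i => f i - g i := fun x =>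
    ((hf x).union (hg x)).subset (Function.support_sub _ _)
  ext x
  rw [LinearMap.sub_apply, locSum_apply hf, locSum_apply hg, locSum_apply hfg]
  exact (finsum_sub_distrib (hf x) (hg x)).symm

lemma smul_locSum {f : ι → Module.End ℂ V} (hf : LocFin f) (c : ℂ) :
    c • locSum f = locSum fun i => c • f i := by
  have h := mul_locSum hf (c • 1)
  simpa using h

lemma locSum_equiv {κ : Type*} (e : κ ≃ ι) {f : ι → Module.End ℂ V} (hf : LocFin f) :
    locSum (fun k => f (e k)) = locSum f := by
  have hfe : LocFin fun k => f (e k) := fun x =>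
    Set.Finite.preimage (f := e) e.injective.injOn (hf x)
  ext x
  rw [locSum_apply hf, locSum_apply hfe]
  exact finsum_comp_equiv e (f := fun i => f i x)

/-- The commutator with a fixed endomorphism passes through a locally finite sum. -/
lemma comm_locSum {f : ι → Module.End ℂ V} (hf : LocFin f) (H : Module.End ℂ V) :
    comm H (locSum f) = locSum fun i => comm H (f i) := by
  simp only [comm]
  rw [mul_locSum hf, locSum_mul hf, locSum_sub (hf.mul_left H) (hf.mul_right H)]

lemma locSum_apply_eq_single {f : ι → Module.End ℂ V} (hf : LocFin f) (x : V) (i : ι)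
    (h : ∀ j, j ≠ i → f j x = 0) : locSum f x = f i x := by
  rw [locSum_apply hf, finsum_eq_single _ i h]

lemma locSum_eq_single {f : ι → Module.End ℂ V} (i : ι)
    (h : ∀ j, j ≠ i → f j = 0) : locSum f = f i := by
  have hf : LocFin f := fun x => (Set.finite_singleton i).subset fun j hj => by
    by_contra hne
    exact hj (by simp only [h j hne, LinearMap.zero_apply])
  ext x
  exact locSum_apply_eq_single hf x i fun j hj => by rw [h j hj, LinearMap.zero_apply]

lemma locSum_zero : locSum (fun _ : ι => (0 : Module.End ℂ V)) = 0 := by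
  ext x
  rw [locSum_apply fun x => by simp]
  simp

end LocallyFinite

/-! ### Exponentials of power series with noncommuting coefficients -/

section ExpSeries

open PowerSeries
open Finset (range)
open Finset.HasAntidiagonal

variable {A : Type*} [Ring A]

lemma commute_of_coeff {f g : PowerSeries A} (h : ∀ i j, Commute (coeff i f) (coeff j g)) :
    Commute f g := by
  ext n
  rw [coeff_mul, coeff_mul, ← Finset.Nat.sum_antidiagonal_swap]
  exact Finset.sum_congr rfl fun p _ => h _ _

lemma coeff_pow_eq_zero {f : PowerSeries A} (hf : coeff 0 f = 0) {n j : ℕ} (h : n < j) :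
    coeff n (f ^ j) = 0 := by
  induction j generalizing n with
  | zero => omega
  | succ j ih =>
    rw [pow_succ', coeff_mul]
    refine Finset.sum_eq_zero fun p hp => ?_
    have hp' := mem_antidiagonal.1 hp
    rcases Nat.eq_zero_or_pos p.1 with h0 | h0
    · rw [h0, hf, zero_mul]
    · rw [ih (by omega), mul_zero]

lemma commute_coeff_pow {f : PowerSeries A} {x : A} (h : ∀ i, Commute x (coeff i f)) (j n : ℕ) :
    Commute x (coeff n (f ^ j)) := by
  induction j generalizing n with
  | zero =>
    rw [pow_zero, coeff_one]
    split_ifs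
    · exact Commute.one_right x
    · exact Commute.zero_right x
  | succ j ih =>
    rw [pow_succ', coeff_mul]
    exact Commute.sum_right _ _ _ fun p _ => (h _).mul_right (ih _)

variable [Algebra ℂ A]

lemma coeff_expSeries {f : PowerSeries A} (hf : coeff 0 f = 0) {n M : ℕ} (h : n < M) :
    coeff n (expSeries f) =
      ∑ j ∈ range M, ((j.factorial : ℂ)⁻¹) • coeff n (f ^ j) := by
  unfold expSeries
  rw [coeff_mk]
  refine Finset.sum_subset (fun x hx => by simp at hx ⊢; omega) fun j _ hj => ?_
  rw [coeff_pow_eq_zero hf (by simpa using hj), smul_zero]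

lemma coeff_zero_expSeries (f : PowerSeries A) : coeff 0 (expSeries f) = 1 := by
  simp [expSeries]

lemma comm_coeff_expSeries_eq_zero {f : PowerSeries A} {x : A} (h : ∀ i, comm x (coeff i f) = 0)
    (n : ℕ) : comm x (coeff n (expSeries f)) = 0 := by
  rw [comm_eq_zero]
  unfold expSeries
  rw [coeff_mk]
  exact Commute.sum_right _ _ _ fun j _ =>
    (commute_coeff_pow (fun i => comm_eq_zero.1 (h i)) j n).smul_right _

/-- The chain rule `δ (exp f) = δ f · exp f` for a derivation `δ` of the algebra of power series
such that `δ f` commutes with `f`. The derivation is assumed to act on each coefficient separately,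
by linear maps `lam n`, so that it can be applied to the infinite sum `exp f`. -/
lemma derivation_expSeries {f : PowerSeries A} (hf : coeff 0 f = 0)
    (δ : PowerSeries A → PowerSeries A) (lam : ℕ → A →ₗ[ℂ] A)
    (hδ : ∀ g n, coeff n (δ g) = lam n (coeff n g))
    (hmul : ∀ g h, δ (g * h) = δ g * h + g * δ h) (hcomm : Commute f (δ f)) :
    δ (expSeries f) = δ f * expSeries f := by
  have hδ1 : δ 1 = 0 := by simpa using hmul 1 1
  have hpow : ∀ j : ℕ, δ (f ^ (j + 1)) = (j + 1 : ℕ) • (δ f * f ^ j) := by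
    intro j
    induction j with
    | zero => simp
    | succ j ih =>
      rw [pow_succ, hmul, ih, add_smul (j + 1) 1, one_smul, (hcomm.pow_left (j + 1)).eq,
        smul_mul_assoc, mul_assoc, ← pow_succ]
  ext n
  -- In degree `n` the sum is cut off one step later on the left than on the right, since `δ` lowers
  -- the exponent of `f ^ j` by one.
  rw [hδ, coeff_expSeries hf (show n < n + 2 by omega), Finset.sum_range_succ', map_add, map_sum]
  simp only [map_smul]
  rw [← hδ, pow_zero, hδ1, map_zero, smul_zero, add_zero, coeff_mul]
  have h2 : ∀ p ∈ antidiagonal n, coeff p.1 (δ f) * coeff p.2 (expSeries f) =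
      ∑ j ∈ range (n + 1), ((j.factorial : ℂ)⁻¹) • (coeff p.1 (δ f) * coeff p.2 (f ^ j)) := by
    intro p hp
    have hp' := mem_antidiagonal.1 hp
    rw [coeff_expSeries hf (show p.2 < n + 1 by omega), Finset.mul_sum]
    simp only [mul_smul_comm]
  rw [Finset.sum_congr rfl h2, Finset.sum_comm]
  refine Finset.sum_congr rfl fun j _ => ?_
  rw [← hδ, hpow, map_nsmul, ← Finset.smul_sum, ← coeff_mul, ← Nat.cast_smul_eq_nsmul ℂ, smul_smul]
  congr 1
  have h3 : ((j : ℂ) + 1) ≠ 0 := Nat.cast_add_one_ne_zero j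
  have h4 : (j.factorial : ℂ) ≠ 0 := by exact_mod_cast j.factorial_ne_zero
  rw [Nat.factorial_succ]
  push_cast
  field_simp

/-- If an element `x` has a scalar commutator with one coefficient of `f` and commutes with all
others, then its commutators with the coefficients of `exp f` shift the degree. -/
lemma comm_coeff_expSeries {f : PowerSeries A} (hf : coeff 0 f = 0) (x : A) (k : ℕ) (c : ℂ)
    (h : ∀ i, comm x (coeff i f) = if i = k then c • (1 : A) else 0) (n : ℕ) :
    comm x (coeff n (expSeries f)) = if k ≤ n then c • coeff (n - k) (expSeries f) else 0 := by
  have key := derivation_expSeries hf (fun g => PowerSeries.mk fun n => comm x (coeff n g))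
    (fun _ => LinearMap.mulLeft ℂ x - LinearMap.mulRight ℂ x)
    (fun g n => by simp [comm])
    (fun g g' => by
      ext n
      simp only [coeff_mk, coeff_mul, map_add, comm,
        Finset.mul_sum, Finset.sum_mul, ← Finset.sum_add_distrib, ← Finset.sum_sub_distrib]
      refine Finset.sum_congr rfl fun p _ => ?_
      noncomm_ring)
    (commute_of_coeff fun i j => by
      rw [coeff_mk, h]
      split_ifs
      · exact (Commute.one_right _).smul_right _
      · exact Commute.zero_right _)
  have h1 := congrArg (coeff n) key
  rw [coeff_mk, coeff_mul] at h1
  rw [h1]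
  simp only [coeff_mk, h, ite_mul, zero_mul, smul_mul_assoc, one_mul]
  split_ifs with hk
  · rw [Finset.sum_eq_single (k, n - k)]
    · simp
    · rintro ⟨a, b⟩ hp hne
      have := mem_antidiagonal.1 hp
      rw [if_neg]
      rintro rfl
      exact hne (Prod.ext rfl (by simp at this ⊢; omega))
    · intro hp
      exact absurd (mem_antidiagonal.2 (by simp; omega)) hp
  · refine Finset.sum_eq_zero fun p hp => ?_
    have := mem_antidiagonal.1 hp
    rw [if_neg (by omega)]

/-- Euler's recursion `n e_n = ∑ i f_i e_{n-i}` for the coefficients of `exp f`. -/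
lemma euler_expSeries {f : PowerSeries A} (hf : coeff 0 f = 0)
    (h : ∀ i j, comm (coeff i f) (coeff j f) = 0) (n : ℕ) :
    (n : ℂ) • coeff n (expSeries f) =
      ∑ p ∈ antidiagonal n, (p.1 : ℂ) • (coeff p.1 f * coeff p.2 (expSeries f)) := by
  have key := derivation_expSeries hf (fun g => PowerSeries.mk fun n => (n : ℂ) • coeff n g)
    (fun n => (n : ℂ) • LinearMap.id) (fun g n => by simp)
    (fun g g' => by
      ext n
      simp only [coeff_mk, coeff_mul, map_add, Finset.smul_sum, ← Finset.sum_add_distrib]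
      refine Finset.sum_congr rfl fun p hp => ?_
      rw [← mem_antidiagonal.1 hp, smul_mul_assoc, mul_smul_comm, ← add_smul]
      push_cast
      rfl)
    (commute_of_coeff fun i j => by
      rw [coeff_mk]
      exact (comm_eq_zero.1 (h i j)).smul_right _)
  have h1 := congrArg (coeff n) key
  rw [coeff_mk, coeff_mul] at h1
  rw [h1]
  simp only [coeff_mk, smul_mul_assoc]

end ExpSeries

variable {ℓ : ℕ}

/-! ### The Heisenberg relations -/

/-- The generator `h s^{-(k+1)}` of the symmetric algebra. -/
noncomputable def creator (h : Cartan ℓ) (k : ℕ) : Sym ℓ := ∑ i, h i • MvPolynomial.X (i, k)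

/-- The derivation of the symmetric algebra by which `h_{(k+1)}` acts. -/
noncomputable def annihilator (h : Cartan ℓ) (k : ℕ) : Derivation ℂ (Sym ℓ) (Sym ℓ) :=
  ((k : ℂ) + 1) • ∑ i, h i • MvPolynomial.pderiv (i, k)

lemma annihilator_apply (h : Cartan ℓ) (k : ℕ) (p : Sym ℓ) :
    annihilator h k p = ((k : ℂ) + 1) • ∑ i, h i • MvPolynomial.pderiv (i, k) p := by
  have := map_sum (Derivation.coeFnAddMonoidHom (R := ℂ) (A := Sym ℓ) (M := Sym ℓ))
    (fun i => h i • MvPolynomial.pderiv (i, k)) Finset.univ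
  have h2 := congrFun this p
  simp only [Derivation.coeFnAddMonoidHom, AddMonoidHom.coe_mk, ZeroHom.coe_mk,
    Finset.sum_apply, Derivation.smul_apply] at h2
  rw [annihilator, Derivation.smul_apply, h2]

lemma heis_negSucc_single (h : Cartan ℓ) (k : ℕ) (γ : Lat ℓ) (p : Sym ℓ) :
    heis h (Int.negSucc k) (Finsupp.single γ p) = Finsupp.single γ (creator h k * p) := by
  simp [heis, onSym, creator, Finset.sum_mul]

lemma heis_zero_single (h : Cartan ℓ) (γ : Lat ℓ) (p : Sym ℓ) :
    heis h 0 (Finsupp.single γ p) = (h ⬝ᵥ toCartan γ) • Finsupp.single γ p := by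
  change heis h (Int.ofNat 0) _ = _
  simp [heis, dotProduct, toCartan]

lemma heis_succ_single (h : Cartan ℓ) (k : ℕ) (γ : Lat ℓ) (p : Sym ℓ) :
    heis h (Int.ofNat (k + 1)) (Finsupp.single γ p) = Finsupp.single γ (annihilator h k p) := by
  simp [heis, onSym, annihilator_apply]

lemma annihilator_X (h : Cartan ℓ) (k : ℕ) (i : Fin ℓ) (n : ℕ) :
    annihilator h k (MvPolynomial.X (i, n)) =
      MvPolynomial.C (if n = k then ((k : ℂ) + 1) * h i else 0) := by
  classical
  rw [annihilator_apply]
  simp only [MvPolynomial.pderiv_X, Pi.single_apply, Prod.mk.injEq]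
  by_cases hn : n = k
  · simp [hn, MvPolynomial.smul_eq_C_mul]
  · simp [hn]

lemma annihilator_creator (h g : Cartan ℓ) (k n : ℕ) :
    annihilator h k (creator g n) =
      MvPolynomial.C (if n = k then ((k : ℂ) + 1) * (h ⬝ᵥ g) else 0) := by
  simp only [creator, map_sum, Derivation.map_smul, annihilator_X]
  simp only [MvPolynomial.smul_eq_C_mul, ← MvPolynomial.C_mul]
  rw [← map_sum MvPolynomial.C]
  refine congrArg _ ?_
  split_ifs
  · simp only [dotProduct, Finset.mul_sum]
    exact Finset.sum_congr rfl fun i _ => by ring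
  · simp

/-- Annihilation operators commute: the commutator of two derivations is a derivation, and this one
kills the generators. -/
lemma annihilator_comm (h g : Cartan ℓ) (k n : ℕ) (p : Sym ℓ) :
    annihilator h k (annihilator g n p) = annihilator g n (annihilator h k p) := by
  have : ⁅annihilator h k, annihilator g n⁆ = 0 := by
    refine MvPolynomial.derivation_ext fun i => ?_
    rw [Derivation.commutator_apply, annihilator_X, annihilator_X]
    simp [MvPolynomial.derivation_C]
  have h2 := congrArg (fun D : Derivation ℂ (Sym ℓ) (Sym ℓ) => D p) this
  rw [← sub_eq_zero, ← Derivation.commutator_apply]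
  exact h2

lemma space_ext {f g : Module.End ℂ (Space ℓ)}
    (h : ∀ γ p, f (Finsupp.single γ p) = g (Finsupp.single γ p)) : f = g :=
  Finsupp.lhom_ext h

lemma comm_heis (h g : Cartan ℓ) (m n : ℤ) :
    comm (heis h m) (heis g n) =
      if m = -n then ((m : ℂ) * (h ⬝ᵥ g)) • (1 : Module.End ℂ (Space ℓ)) else 0 := by
  -- The only case with a nonzero commutator: annihilation against creation operators.
  have anti : ∀ (h g : Cartan ℓ) (k n : ℕ),
      comm (heis h (Int.ofNat (k + 1))) (heis g (Int.negSucc n)) =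
      if Int.ofNat (k + 1) = - Int.negSucc n then ((((Int.ofNat (k + 1)) : ℤ) : ℂ) * (h ⬝ᵥ g)) •
        (1 : Module.End ℂ (Space ℓ)) else 0 := by
    intro h g k n
    refine space_ext fun γ p => ?_
    rw [comm, LinearMap.sub_apply, Module.End.mul_apply,
      Module.End.mul_apply, heis_negSucc_single, heis_succ_single, heis_succ_single,
      heis_negSucc_single, Derivation.leibniz, annihilator_creator, ← Finsupp.single_sub]
    have e : (Int.ofNat (k + 1) = - Int.negSucc n) ↔ n = k := by
      rw [Int.neg_negSucc]; simp only [Int.ofNat_eq_natCast]; omega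
    simp only [e]
    split_ifs with hk
    · simp [smul_eq_mul, mul_comm p, MvPolynomial.smul_eq_C_mul]
    · simp [smul_eq_mul]
  rcases m with (_ | k) | k <;> rcases n with (_ | n) | n
  · refine space_ext fun γ p => ?_
    change comm (heis h 0) (heis g 0) _ = _
    simp [comm, heis_zero_single, smul_comm (h ⬝ᵥ toCartan γ)]
  · refine (space_ext fun γ p => ?_).trans
      (if_neg (by simp only [Int.ofNat_eq_natCast]; omega)).symm
    change comm (heis h 0) (heis g _) _ = _
    simp only [comm, heis_zero_single, heis_succ_single,
      LinearMap.sub_apply, Module.End.mul_apply, map_smul, sub_self, LinearMap.zero_apply]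
  · refine (space_ext fun γ p => ?_).trans
      (if_neg (by simp only [Int.ofNat_eq_natCast]; omega)).symm
    change comm (heis h 0) (heis g _) _ = _
    simp only [comm, heis_zero_single, heis_negSucc_single,
      LinearMap.sub_apply, Module.End.mul_apply, map_smul, sub_self, LinearMap.zero_apply]
  · refine (space_ext fun γ p => ?_).trans
      (if_neg (by simp only [Int.ofNat_eq_natCast]; omega)).symm
    change comm (heis h _) (heis g 0) _ = _
    simp only [comm, heis_zero_single, heis_succ_single,
      LinearMap.sub_apply, Module.End.mul_apply, map_smul, sub_self, LinearMap.zero_apply]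
  · refine (space_ext fun γ p => ?_).trans
      (if_neg (by simp only [Int.ofNat_eq_natCast]; omega)).symm
    simp only [comm, heis_succ_single, annihilator_comm h g,
      LinearMap.sub_apply, Module.End.mul_apply, sub_self, LinearMap.zero_apply]
  · exact anti h g k n
  · refine (space_ext fun γ p => ?_).trans (if_neg (by simp)).symm
    change comm (heis h _) (heis g 0) _ = _
    simp only [comm, heis_zero_single, heis_negSucc_single,
      LinearMap.sub_apply, Module.End.mul_apply, map_smul, sub_self, LinearMap.zero_apply]
  · rw [← neg_comm, anti]
    have e : (Int.ofNat (n + 1) = - Int.negSucc k) ↔ Int.negSucc k = -Int.ofNat (n + 1) := by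
      omega
    simp only [e]
    split_ifs with hk
    · rw [hk, dotProduct_comm g h, Int.cast_neg, neg_mul]
      exact (neg_smul _ (1 : Module.End ℂ (Space ℓ))).symm
    · simp
  · refine (space_ext fun γ p => ?_).trans (if_neg (by omega)).symm
    simp only [comm, heis_negSucc_single, mul_left_comm (creator h k),
      LinearMap.sub_apply, Module.End.mul_apply, sub_self, LinearMap.zero_apply]

lemma comm_heis_eq_zero {h g : Cartan ℓ} {m n : ℤ} (hmn : m ≠ -n) :
    comm (heis h m) (heis g n) = 0 := by
  rw [comm_heis, if_neg hmn]

/-! ### The exponentials of the creation and of the annihilation part -/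

/-- The series `∑_{n>0} α_{(-n)} z^n / n`. -/
noncomputable def createSeries (α : Lat ℓ) : PowerSeries (Module.End ℂ (Space ℓ)) :=
  PowerSeries.mk fun k : ℕ => if k = 0 then 0 else ((k : ℂ)⁻¹) • heis (toCartan α) (-(k : ℤ))

/-- The series `∑_{n<0} α_{(-n)} z^n / n` in the variable `z⁻¹`. -/
noncomputable def annihSeries (α : Lat ℓ) : PowerSeries (Module.End ℂ (Space ℓ)) :=
  PowerSeries.mk fun k : ℕ => if k = 0 then 0 else (-(k : ℂ)⁻¹) • heis (toCartan α) (k : ℤ)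

/-- The coefficient of `z^n` in `exp (∑_{n>0} α_{(-n)} z^n / n)`. -/
noncomputable def createCoeff (α : Lat ℓ) (n : ℕ) : Module.End ℂ (Space ℓ) :=
  PowerSeries.coeff n (expSeries (createSeries α))

/-- The coefficient of `z^{-n}` in `exp (∑_{n<0} α_{(-n)} z^n / n)`. -/
noncomputable def annihCoeff (α : Lat ℓ) (n : ℕ) : Module.End ℂ (Space ℓ) :=
  PowerSeries.coeff n (expSeries (annihSeries α))

lemma expCreate_natCast (α : Lat ℓ) (n : ℕ) : expCreate α (n : ℤ) = createCoeff α n := by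
  simp [expCreate, createCoeff, createSeries]

lemma expCreate_of_neg (α : Lat ℓ) {n : ℤ} (hn : n < 0) : expCreate α n = 0 := by
  simp [expCreate, hn]

lemma expAnnih_neg_natCast (α : Lat ℓ) (n : ℕ) : expAnnih α (-(n : ℤ)) = annihCoeff α n := by
  simp [expAnnih, annihCoeff, annihSeries]

lemma expAnnih_of_pos (α : Lat ℓ) {n : ℤ} (hn : 0 < n) : expAnnih α n = 0 := by
  simp [expAnnih, hn]

lemma coeff_zero_createSeries (α : Lat ℓ) : PowerSeries.coeff 0 (createSeries α) = 0 := by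
  simp [createSeries]

lemma coeff_zero_annihSeries (α : Lat ℓ) : PowerSeries.coeff 0 (annihSeries α) = 0 := by
  simp [annihSeries]

lemma createCoeff_zero (α : Lat ℓ) : createCoeff α 0 = 1 := coeff_zero_expSeries _

lemma annihCoeff_zero (α : Lat ℓ) : annihCoeff α 0 = 1 := coeff_zero_expSeries _

lemma comm_coeff_createSeries (α : Lat ℓ) {T : Module.End ℂ (Space ℓ)}
    (h : ∀ k : ℕ, 0 < k → comm T (heis (toCartan α) (-(k : ℤ))) = 0) (n : ℕ) :
    comm T (PowerSeries.coeff n (createSeries α)) = 0 := by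
  simp only [createSeries, PowerSeries.coeff_mk]
  split_ifs with h0
  · exact comm_zero _
  · rw [comm_smul, h n (Nat.pos_of_ne_zero h0), smul_zero]

lemma comm_coeff_annihSeries (α : Lat ℓ) {T : Module.End ℂ (Space ℓ)}
    (h : ∀ k : ℕ, 0 < k → comm T (heis (toCartan α) (k : ℤ)) = 0) (n : ℕ) :
    comm T (PowerSeries.coeff n (annihSeries α)) = 0 := by
  simp only [annihSeries, PowerSeries.coeff_mk]
  split_ifs with h0
  · exact comm_zero _
  · rw [comm_smul, h n (Nat.pos_of_ne_zero h0), smul_zero]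

/-- Euler's recursion `n C_n = ∑_{k>0} α_{(-k)} C_{n-k}`. -/
lemma createCoeff_euler (α : Lat ℓ) (n : ℕ) :
    (n : ℂ) • createCoeff α n = ∑ p ∈ Finset.HasAntidiagonal.antidiagonal n,
      if p.1 = 0 then 0 else heis (toCartan α) (-(p.1 : ℤ)) * createCoeff α p.2 := by
  refine (euler_expSeries (coeff_zero_createSeries α) (fun i j => ?_) n).trans ?_
  · refine comm_coeff_createSeries α (fun k hk => ?_) j
    exact comm_eq_zero_symm
      (comm_coeff_createSeries α (fun k' hk' => comm_heis_eq_zero (by omega)) i)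
  · refine Finset.sum_congr rfl fun p _ => ?_
    simp only [createSeries, PowerSeries.coeff_mk]
    split_ifs with h0
    · simp
    · have : (p.1 : ℂ) ≠ 0 := by exact_mod_cast h0
      rw [smul_mul_assoc, smul_smul, mul_inv_cancel₀ this, one_smul]
      rfl

/-- Euler's recursion `n B_n = -∑_{k>0} B_{n-k} α_{(k)}`, with the Heisenberg operators on the
right, where they meet the vector acted on. -/
lemma annihCoeff_euler (α : Lat ℓ) (n : ℕ) :
    (n : ℂ) • annihCoeff α n = ∑ p ∈ Finset.HasAntidiagonal.antidiagonal n,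
      if p.1 = 0 then 0 else -(annihCoeff α p.2 * heis (toCartan α) (p.1 : ℤ)) := by
  refine (euler_expSeries (coeff_zero_annihSeries α) (fun i j => ?_) n).trans ?_
  · refine comm_coeff_annihSeries α (fun k hk => ?_) j
    exact comm_eq_zero_symm
      (comm_coeff_annihSeries α (fun k' hk' => comm_heis_eq_zero (by omega)) i)
  · refine Finset.sum_congr rfl fun p _ => ?_
    rw [annihSeries, PowerSeries.coeff_mk]
    split_ifs with h0
    · simp
    · have h1 : (p.1 : ℂ) ≠ 0 := by exact_mod_cast h0
      have h2 : comm (heis (toCartan α) (p.1 : ℤ)) (annihCoeff α p.2) = 0 :=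
        comm_coeff_expSeries_eq_zero
          (comm_coeff_annihSeries α fun k hk => comm_heis_eq_zero (by omega)) _
      rw [smul_mul_assoc, smul_smul, mul_neg, mul_inv_cancel₀ h1]
      refine (neg_one_smul ℂ (heis (toCartan α) (p.1 : ℤ) * annihCoeff α p.2)).trans ?_
      rw [← sub_eq_zero.1 h2]

/-- `[h_{(k)}, C(z)] = (h|α) z^k C(z)` for the exponential `C(z)` of the creation part, if `k > 0`;
otherwise the two commute. -/
lemma comm_heis_expCreate (h : Cartan ℓ) (α : Lat ℓ) (k n : ℤ) :
    comm (heis h k) (expCreate α n) =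
      if 0 < k then (h ⬝ᵥ toCartan α) • expCreate α (n - k) else 0 := by
  rcases lt_or_ge n 0 with hn | hn
  · rw [expCreate_of_neg α hn, comm_zero]
    split_ifs with hk
    · rw [expCreate_of_neg α (by omega), smul_zero]
    · rfl
  lift n to ℕ using hn
  rw [expCreate_natCast]
  split_ifs with hk
  · lift k to ℕ using hk.le
    refine (comm_coeff_expSeries (coeff_zero_createSeries α) (heis h k) k (h ⬝ᵥ toCartan α)
      (fun i => ?_) n).trans ?_
    · simp only [createSeries, PowerSeries.coeff_mk]
      split_ifs with h0 h1 h1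
      · omega
      · exact comm_zero _
      · subst h1
        rw [comm_smul, comm_heis, if_pos (by omega), smul_smul]
        have : (i : ℂ) ≠ 0 := by exact_mod_cast h0
        push_cast
        rw [inv_mul_cancel_left₀ this]
      · rw [comm_smul, comm_heis, if_neg (by omega), smul_zero]
    · split_ifs with hkn
      · rw [← Nat.cast_sub hkn, expCreate_natCast]
        rfl
      · rw [expCreate_of_neg α (by omega), smul_zero]
  · exact comm_coeff_expSeries_eq_zero
      (comm_coeff_createSeries α fun i hi => comm_heis_eq_zero (by omega)) _

/-- `[h_{(k)}, B(z)] = (h|α) z^k B(z)` for the exponential `B(z)` of the annihilation part, if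
`k < 0`; otherwise the two commute. -/
lemma comm_heis_expAnnih (h : Cartan ℓ) (α : Lat ℓ) (k n : ℤ) :
    comm (heis h k) (expAnnih α n) =
      if k < 0 then (h ⬝ᵥ toCartan α) • expAnnih α (n - k) else 0 := by
  rcases lt_or_ge 0 n with hn | hn
  · rw [expAnnih_of_pos α hn, comm_zero]
    split_ifs with hk
    · rw [expAnnih_of_pos α (by omega), smul_zero]
    · rfl
  obtain ⟨n, rfl⟩ := Int.exists_eq_neg_ofNat hn
  rw [expAnnih_neg_natCast]
  split_ifs with hk
  · obtain ⟨k, rfl⟩ := Int.exists_eq_neg_ofNat hk.le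
    refine (comm_coeff_expSeries (coeff_zero_annihSeries α) (heis h (-k)) k (h ⬝ᵥ toCartan α)
      (fun i => ?_) n).trans ?_
    · simp only [annihSeries, PowerSeries.coeff_mk]
      split_ifs with h0 h1 h1
      · omega
      · exact comm_zero _
      · subst h1
        rw [comm_smul, comm_heis, if_pos (by omega), smul_smul]
        have : (i : ℂ) ≠ 0 := by exact_mod_cast h0
        push_cast
        rw [neg_mul, neg_mul, mul_neg, neg_neg, inv_mul_cancel_left₀ this]
      · rw [comm_smul, comm_heis, if_neg (by omega), smul_zero]
    · split_ifs with hkn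
      · rw [show (-(n : ℤ) - -(k : ℤ)) = -((n - k : ℕ) : ℤ) by omega, expAnnih_neg_natCast]
        rfl
      · rw [expAnnih_of_pos α (by omega), smul_zero]
  · exact comm_coeff_expSeries_eq_zero
      (comm_coeff_annihSeries α fun i hi => comm_heis_eq_zero (by omega)) _

/-! ### Vertex operators and their commutators with the Heisenberg operators -/

lemma toCartan_add (α β : Lat ℓ) : toCartan (α + β) = toCartan α + toCartan β := by
  ext i
  simp [toCartan]

lemma heis_single_C (h : Cartan ℓ) {k : ℤ} (hk : 0 < k) (γ : Lat ℓ) (a : ℂ) :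
    heis h k (Finsupp.single γ (MvPolynomial.C a)) = 0 := by
  obtain ⟨n, rfl⟩ : ∃ n : ℕ, k = Int.ofNat (n + 1) := ⟨(k - 1).toNat, by simp; omega⟩
  rw [heis_succ_single, MvPolynomial.derivation_C, Finsupp.single_zero]

lemma expAnnih_single_C (α : Lat ℓ) {n : ℤ} (hn : n ≠ 0) (γ : Lat ℓ) (a : ℂ) :
    expAnnih α n (Finsupp.single γ (MvPolynomial.C a)) = 0 := by
  rcases lt_or_ge 0 n with h0 | h0
  · rw [expAnnih_of_pos α h0, LinearMap.zero_apply]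
  obtain ⟨n, rfl⟩ := Int.exists_eq_neg_ofNat h0
  rw [expAnnih_neg_natCast]
  have h1 : (n : ℂ) ≠ 0 := by
    rintro h
    exact hn (by rw [Nat.cast_eq_zero.1 h]; rfl)
  have h2 := congrArg (fun T : Module.End ℂ (Space ℓ) => T (Finsupp.single γ (MvPolynomial.C a)))
    (annihCoeff_euler α n)
  simp only [LinearMap.smul_apply, LinearMap.sum_apply] at h2
  rw [Finset.sum_eq_zero] at h2
  · exact (smul_eq_zero.1 h2).resolve_left h1
  · intro p _
    split_ifs with hp
    · rfl
    · rw [LinearMap.neg_apply, Module.End.mul_apply, heis_single_C _ (by omega), map_zero, neg_zero]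

lemma creator_single (i : Fin ℓ) (k : ℕ) :
    creator (Pi.single i (1 : ℂ)) k = MvPolynomial.X (i, k) := by
  simp [creator, Pi.single_apply]

/-- Induction on vectors: creation operators generate the space from the vectors `a ⊗ e^γ`. -/
lemma space_induction {motive : Space ℓ → Prop}
    (base : ∀ γ a, motive (Finsupp.single γ (MvPolynomial.C a)))
    (add : ∀ x y, motive x → motive y → motive (x + y))
    (create : ∀ (h : Cartan ℓ) (k : ℕ) (x), motive x → motive (heis h (Int.negSucc k) x))
    (x : Space ℓ) : motive x := by
  induction x using Finsupp.induction_linear with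
  | zero => simpa using base 0 0
  | add x y hx hy => exact add x y hx hy
  | single γ p =>
    induction p using MvPolynomial.induction_on with
    | C a => exact base γ a
    | add p q hp hq => rw [Finsupp.single_add]; exact add _ _ hp hq
    | mul_X p i hp =>
      have := create (Pi.single i.1 1) i.2 _ hp
      rwa [heis_negSucc_single, creator_single, mul_comm] at this

/-- The annihilation part acts locally finitely: `B(z) h_{(-k)} = (h_{(-k)} - (h|α) z^{-k}) B(z)`,
so that each creation operator lowers the bound by a finite amount. -/
lemma expAnnih_eventually_zero (α : Lat ℓ) (x : Space ℓ) :
    ∃ N : ℤ, ∀ n < N, expAnnih α n x = 0 := by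
  induction x using space_induction with
  | base γ a => exact ⟨0, fun n hn => expAnnih_single_C α hn.ne γ a⟩
  | add x y hx hy =>
    obtain ⟨N, hN⟩ := hx
    obtain ⟨M, hM⟩ := hy
    refine ⟨min N M, fun n hn => ?_⟩
    rw [map_add, hN n (by omega), hM n (by omega), add_zero]
  | create h k x hx =>
    obtain ⟨N, hN⟩ := hx
    refine ⟨N - k - 1, fun n hn => ?_⟩
    have h1 := congrArg (fun T : Module.End ℂ (Space ℓ) => T x)
      (comm_heis_expAnnih h α (Int.negSucc k) n)
    simp only [comm, if_pos (Int.negSucc_lt_zero k), LinearMap.sub_apply, Module.End.mul_apply,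
      LinearMap.smul_apply] at h1
    rw [hN n (by omega), hN _ (by omega), map_zero, smul_zero, zero_sub, neg_eq_zero] at h1
    exact h1

lemma locFin_exp (α : Lat ℓ) (n : ℤ) : LocFin fun k : ℤ => expCreate α k * expAnnih α (n - k) := by
  intro x
  obtain ⟨N, hN⟩ := expAnnih_eventually_zero α x
  refine (Set.finite_Icc 0 (n - N)).subset fun k hk => ?_
  rw [Function.mem_support, Module.End.mul_apply] at hk
  refine ⟨not_lt.1 fun h => hk ?_, not_lt.1 fun h => hk ?_⟩
  · rw [expCreate_of_neg α h, LinearMap.zero_apply]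
  · rw [hN _ (by omega), map_zero]

/-- The coefficient of `z^n` in the product of the two exponentials of `E^α(z)`. -/
noncomputable def expPart (α : Lat ℓ) (n : ℤ) : Module.End ℂ (Space ℓ) :=
  mulD (expCreate α) (expAnnih α) n

lemma comm_heis_expPart (h : Cartan ℓ) (α : Lat ℓ) (k n : ℤ) :
    comm (heis h k) (expPart α n) =
      if k = 0 then 0 else (h ⬝ᵥ toCartan α) • expPart α (n - k) := by
  unfold expPart mulD
  rw [comm_locSum (locFin_exp α n)]
  simp only [comm_mul, comm_heis_expCreate, comm_heis_expAnnih]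
  rcases lt_trichotomy k 0 with hk | hk | hk
  · rw [if_neg hk.ne, smul_locSum (locFin_exp α (n - k))]
    simp only [if_pos hk, if_neg hk.not_gt, zero_mul, zero_add, mul_smul_comm, sub_right_comm n k]
  · simp only [hk, lt_irrefl, if_false, if_true, zero_mul, mul_zero, add_zero]
    exact locSum_zero
  · rw [if_neg hk.ne', ← locSum_equiv (Equiv.subRight k) (locFin_exp α (n - k)),
      smul_locSum]
    · simp only [if_pos hk, if_neg hk.not_gt, mul_zero, add_zero, smul_mul_assoc,
        Equiv.subRight_apply, sub_sub_sub_cancel_right]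
    · intro x
      exact (locFin_exp α (n - k) x).preimage (f := Equiv.subRight k)
        (Equiv.subRight k).injective.injOn

lemma zPow_single (α γ : Lat ℓ) (n : ℤ) (p : Sym ℓ) :
    zPow α n (Finsupp.single γ p) = if latForm α γ = n then Finsupp.single γ p else 0 := by
  simp only [zPow, Finsupp.lsum_single]
  split_ifs <;> rfl

lemma expOp_single (α γ : Lat ℓ) (p : Sym ℓ) :
    expOp α (Finsupp.single γ p) =
      (((eps α γ : ℤˣ) : ℤ) : ℂ) • Finsupp.single (α + γ) p := by
  simp only [expOp, Finsupp.lsum_single]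
  rfl

lemma comm_zPow_heis (α : Lat ℓ) (n : ℤ) (h : Cartan ℓ) (k : ℤ) :
    comm (zPow α n) (heis h k) = 0 := by
  refine space_ext fun γ p => ?_
  simp only [comm, LinearMap.sub_apply, Module.End.mul_apply, LinearMap.zero_apply, sub_eq_zero]
  rcases k with (_ | k) | k
  · change zPow α n (heis h 0 _) = heis h 0 _
    rw [heis_zero_single, map_smul, zPow_single]
    split_ifs
    · rw [heis_zero_single]
    · rw [smul_zero, map_zero]
  · rw [heis_succ_single, zPow_single, zPow_single]
    split_ifs
    · rw [heis_succ_single]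
    · rw [map_zero]
  · rw [heis_negSucc_single, zPow_single, zPow_single]
    split_ifs
    · rw [heis_negSucc_single]
    · rw [map_zero]

lemma comm_heis_expOp (h : Cartan ℓ) (α : Lat ℓ) (k : ℤ) :
    comm (heis h k) (expOp α) = if k = 0 then (h ⬝ᵥ toCartan α) • expOp α else 0 := by
  refine space_ext fun γ p => ?_
  simp only [comm, LinearMap.sub_apply, Module.End.mul_apply]
  rcases k with (_ | k) | k
  · change heis h 0 _ - expOp α (heis h 0 _) = _
    rw [if_pos (show Int.ofNat 0 = 0 from rfl), LinearMap.smul_apply, heis_zero_single,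
      expOp_single, map_smul, map_smul,
      heis_zero_single, expOp_single, toCartan_add, dotProduct_add, smul_comm, add_smul,
      add_sub_cancel_right]
  · rw [if_neg (by simp only [Int.ofNat_eq_natCast]; omega), heis_succ_single, expOp_single,
      expOp_single, map_smul, heis_succ_single, sub_self, LinearMap.zero_apply]
  · rw [if_neg (by omega), heis_negSucc_single, expOp_single,
      expOp_single, map_smul, heis_negSucc_single, sub_self, LinearMap.zero_apply]

lemma comm_zPow_expCreate (α β : Lat ℓ) (m k : ℤ) : comm (zPow α m) (expCreate β k) = 0 := by
  rcases lt_or_ge k 0 with hk | hk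
  · rw [expCreate_of_neg β hk, comm_zero]
  · lift k to ℕ using hk
    rw [expCreate_natCast]
    exact comm_coeff_expSeries_eq_zero
      (comm_coeff_createSeries β fun i _ => comm_zPow_heis α m _ _) _

lemma comm_zPow_expPart (α : Lat ℓ) (m n : ℤ) : comm (zPow α m) (expPart α n) = 0 := by
  have hB : ∀ k, comm (zPow α m) (expAnnih α k) = 0 := by
    intro k
    rcases lt_or_ge 0 k with hk | hk
    · rw [expAnnih_of_pos α hk, comm_zero]
    · obtain ⟨k, rfl⟩ := Int.exists_eq_neg_ofNat hk
      rw [expAnnih_neg_natCast]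
      exact comm_coeff_expSeries_eq_zero
        (comm_coeff_annihSeries α fun i _ => comm_zPow_heis α m _ _) _
  unfold expPart mulD
  rw [comm_locSum (locFin_exp α n)]
  simp only [comm_mul, comm_zPow_expCreate, hB, zero_mul, mul_zero, add_zero]
  exact locSum_zero

lemma locFin_zPow (α : Lat ℓ) : LocFin (zPow α) := by
  intro x
  induction x using Finsupp.induction_linear with
  | zero => simp
  | add x y hx hy =>
    simp only [map_add]
    exact (hx.union hy).subset (Function.support_add _ _)
  | single γ p =>
    refine (Set.finite_singleton (latForm α γ)).subset fun k hk => ?_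
    rw [Function.mem_support, zPow_single] at hk
    by_contra h
    exact hk (if_neg fun e => h e.symm)

lemma locFin_zPow_expPart (α : Lat ℓ) (n : ℤ) :
    LocFin fun k : ℤ => zPow α k * expPart α (n - k) := by
  intro x
  refine (locFin_zPow α x).subset fun k hk h0 => hk ?_
  have h1 := sub_eq_zero.1 (comm_zPow_expPart α k (n - k))
  beta_reduce at h0 ⊢
  rw [h1, Module.End.mul_apply, h0, map_zero]

lemma vertexOp_def (α : Lat ℓ) (n : ℤ) :
    vertexOp α n = expOp α * locSum fun k : ℤ => zPow α k * expPart α (n - k) := rfl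

/-- The action of `E^α(z)` on vectors of charge `γ`. -/
lemma vertexOp_apply {α γ : Lat ℓ} (n : ℤ) {x : Space ℓ}
    (hx : ∀ k, zPow α k x = if latForm α γ = k then x else 0) :
    vertexOp α n x = expOp α (expPart α (n - latForm α γ) x) := by
  have h1 : ∀ k, zPow α k * expPart α (n - k) = expPart α (n - k) * zPow α k := fun k =>
    sub_eq_zero.1 (comm_zPow_expPart α k (n - k))
  rw [vertexOp_def, Module.End.mul_apply,
    locSum_apply_eq_single (locFin_zPow_expPart α n) _ (latForm α γ)]
  · rw [h1, Module.End.mul_apply, hx, if_pos rfl]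
  · intro k hk
    rw [h1, Module.End.mul_apply, hx, if_neg hk.symm, map_zero]

/-- `[h_{(k)}, E^α(z)] = (h|α) z^k E^α(z)`. -/
lemma comm_heis_vertexOp (h : Cartan ℓ) (α : Lat ℓ) (k n : ℤ) :
    comm (heis h k) (vertexOp α n) = (h ⬝ᵥ toCartan α) • vertexOp α (n - k) := by
  rw [vertexOp_def, vertexOp_def, comm_mul, comm_locSum (locFin_zPow_expPart α n), comm_heis_expOp]
  simp only [comm_mul, comm_eq_zero_symm (comm_zPow_heis α _ h k), zero_mul, zero_add,
    comm_heis_expPart]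
  split_ifs with hk
  · subst hk
    rw [sub_zero, smul_mul_assoc]
    simp only [mul_zero, add_zero, locSum_zero]
  · simp only [mul_smul_comm, zero_mul, zero_add, sub_right_comm n _ k]
    rw [← smul_locSum (locFin_zPow_expPart α (n - k)), mul_smul_comm]

/-! ### Constant coefficients determine bilocal operators -/

/-- The constant coefficient of the component of a vector in `S ⊗ e^γ`. -/
noncomputable def constCoeff (γ : Lat ℓ) : Space ℓ →ₗ[ℂ] ℂ :=
  MvPolynomial.lcoeff ℂ 0 ∘ₗ Finsupp.lapply γ

lemma constCoeff_apply (γ : Lat ℓ) (x : Space ℓ) :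
    constCoeff γ x = MvPolynomial.coeff 0 (x γ) := rfl

lemma heis_succ_apply (h : Cartan ℓ) (k : ℕ) (x : Space ℓ) (γ : Lat ℓ) :
    heis h (Int.ofNat (k + 1)) x γ = annihilator h k (x γ) := by
  induction x using Finsupp.induction_linear with
  | zero => simp
  | add x y hx hy => rw [map_add, Finsupp.add_apply, hx, hy, Finsupp.add_apply, map_add]
  | single δ p =>
    rw [heis_succ_single]
    rcases eq_or_ne δ γ with rfl | hne
    · simp
    · simp [hne]

/-- A subspace that is stable under the annihilation operators and on which all constant
coefficients vanish is zero: the coefficients of a polynomial are, up to nonzero factors, the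
constant coefficients of its iterated derivatives. -/
lemma eq_zero_of_constCoeff (W : Submodule ℂ (Space ℓ))
    (hW : ∀ x ∈ W, ∀ (h : Cartan ℓ) (k : ℕ), heis h (Int.ofNat (k + 1)) x ∈ W)
    (h0 : ∀ x ∈ W, ∀ γ, constCoeff γ x = 0) {x : Space ℓ} (hx : x ∈ W) : x = 0 := by
  have key : ∀ n : ℕ, ∀ d : Fin ℓ × ℕ →₀ ℕ, d.degree = n → ∀ x ∈ W, ∀ γ,
      MvPolynomial.coeff d (x γ) = 0 := by
    intro n
    induction n with
    | zero =>
      intro d hd x hx γ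
      rw [(Finsupp.degree_eq_zero_iff d).1 hd]
      exact h0 x hx γ
    | succ n ih =>
      intro d hd x hx γ
      obtain ⟨i, hi⟩ : ∃ i, d i ≠ 0 := by
        by_contra! hc
        rw [(Finsupp.degree_eq_zero_iff d).2 (Finsupp.ext hc)] at hd
        omega
      have hle : Finsupp.single i 1 ≤ d := by
        rw [Finsupp.single_le_iff]
        omega
      obtain ⟨e, rfl⟩ := exists_add_of_le hle
      have he : e.degree = n := by
        rw [map_add, Finsupp.degree_single] at hd
        omega
      have h1 := ih e he _ (hW x hx (Pi.single i.1 1) i.2) γ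
      have h3 : ((i.2 : ℂ) + 1) ≠ 0 := Nat.cast_add_one_ne_zero _
      have h4 : ((e i : ℂ) + 1) ≠ 0 := Nat.cast_add_one_ne_zero _
      rw [heis_succ_apply, annihilator_apply, Finset.sum_eq_single i.1 (fun j _ hj => by simp [hj])
        (by simp), Pi.single_eq_same, one_smul, MvPolynomial.coeff_smul,
        MvPolynomial.coeff_pderiv, smul_eq_mul, add_comm e] at h1
      exact (mul_eq_zero.1 ((mul_eq_zero.1 h1).resolve_left h3)).resolve_right h4
  refine Finsupp.ext fun γ => MvPolynomial.ext _ _ fun d => ?_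
  simpa using key _ d rfl x hx γ

/-- A family `D_{a,b}` of operators, thought of as the coefficients of a distribution `D(z,w)`, that
satisfies `[h_{(k)}, D(z,w)] = ((h|α) z^k + (h|β) w^k) D(z,w)` vanishes as soon as the constant
coefficients of all vectors `D_{a,b} e^γ` do. -/
theorem bilocal_eq_zero (α β : Lat ℓ) (D : ℤ → ℤ → Module.End ℂ (Space ℓ))
    (hD : ∀ h k a b, comm (heis h k) (D a b) =
      (h ⬝ᵥ toCartan α) • D (a - k) b + (h ⬝ᵥ toCartan β) • D a (b - k))
    (h0 : ∀ a b γ γ', constCoeff γ' (D a b (Finsupp.single γ 1)) = 0) (a b : ℤ) : D a b = 0 := by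
  have hDx : ∀ h k a b x, heis h k (D a b x) = D a b (heis h k x) +
      ((h ⬝ᵥ toCartan α) • D (a - k) b x + (h ⬝ᵥ toCartan β) • D a (b - k) x) := by
    intro h k a b x
    have := congrArg (fun T : Module.End ℂ (Space ℓ) => T x) (hD h k a b)
    simp only [comm, LinearMap.sub_apply, Module.End.mul_apply, LinearMap.add_apply,
      LinearMap.smul_apply] at this
    rw [← this, add_sub_cancel]
  suffices h : ∀ x a b, D a b x = 0 from LinearMap.ext fun x => h x a b
  intro x
  induction x using space_induction with
  | base γ c =>
    intro a b
    -- As annihilation operators kill `e^γ`, the relation `hD` makes this span stable under them.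
    set W := Submodule.span ℂ (Set.range fun p : ℤ × ℤ => D p.1 p.2 (Finsupp.single γ 1))
    have hmem : ∀ a b, D a b (Finsupp.single γ 1) ∈ W := fun a b =>
      Submodule.subset_span ⟨(a, b), rfl⟩
    have h1 : D a b (Finsupp.single γ 1) = 0 := by
      refine eq_zero_of_constCoeff W (fun x hx h k => ?_) (fun x hx γ' => ?_) (hmem a b)
      · have hle : W ≤ W.comap (heis h (Int.ofNat (k + 1))) := by
          refine Submodule.span_le.2 ?_
          rintro _ ⟨p, rfl⟩
          change heis h _ (D p.1 p.2 _) ∈ W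
          have hz : heis h (Int.ofNat (k + 1)) (Finsupp.single γ (1 : Sym ℓ)) = 0 :=
            heis_single_C h (by simp only [Int.ofNat_eq_natCast]; omega) γ 1
          rw [hDx, hz, map_zero, zero_add]
          exact add_mem (W.smul_mem _ (hmem _ _)) (W.smul_mem _ (hmem _ _))
        exact hle hx
      · have hle : W ≤ LinearMap.ker (constCoeff γ') := by
          refine Submodule.span_le.2 ?_
          rintro _ ⟨p, rfl⟩
          exact h0 _ _ _ _
        exact hle hx
    have h2 : Finsupp.single γ (MvPolynomial.C c : Sym ℓ) = c • Finsupp.single γ 1 := by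
      rw [Finsupp.smul_single, MvPolynomial.smul_eq_C_mul, mul_one]
    rw [h2, map_smul, h1, smul_zero]
  | add x y hx hy =>
    intro a b
    rw [map_add, hx, hy, add_zero]
  | create h k x hx =>
    intro a b
    have := hDx h (Int.negSucc k) a b x
    rw [hx, hx, hx, map_zero, smul_zero, smul_zero, add_zero, add_zero] at this
    exact this.symm

/-! ### Constant coefficients of products of vertex operators -/

lemma constCoeff_single (γ γ' : Lat ℓ) (p : Sym ℓ) :
    constCoeff γ' (Finsupp.single γ p) = if γ' = γ then MvPolynomial.coeff 0 p else 0 := by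
  rw [constCoeff_apply, Finsupp.single_apply]
  simp only [eq_comm (a := γ)]
  split_ifs
  · rfl
  · exact MvPolynomial.coeff_zero 0

lemma constCoeff_heis_neg (h : Cartan ℓ) {k : ℤ} (hk : k < 0) (γ : Lat ℓ) (x : Space ℓ) :
    constCoeff γ (heis h k x) = 0 := by
  obtain ⟨n, rfl⟩ := Int.eq_negSucc_of_lt_zero hk
  induction x using Finsupp.induction_linear with
  | zero => simp
  | add x y hx hy => rw [map_add, map_add, hx, hy, add_zero]
  | single δ p =>
    rw [heis_negSucc_single, constCoeff_single]
    split_ifs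
    · rw [← MvPolynomial.constantCoeff_eq, map_mul]
      simp [creator, MvPolynomial.smul_eq_C_mul]
    · rfl

lemma constCoeff_createCoeff (α : Lat ℓ) {n : ℕ} (hn : n ≠ 0) (γ : Lat ℓ) (x : Space ℓ) :
    constCoeff γ (createCoeff α n x) = 0 := by
  have h1 : (n : ℂ) ≠ 0 := by exact_mod_cast hn
  have h2 := congrArg (fun T : Module.End ℂ (Space ℓ) => constCoeff γ (T x))
    (createCoeff_euler α n)
  simp only [LinearMap.smul_apply, LinearMap.sum_apply, map_smul, map_sum] at h2
  rw [Finset.sum_eq_zero] at h2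
  · exact (smul_eq_zero.1 h2).resolve_left h1
  · intro p _
    split_ifs with hp
    · exact map_zero _
    · exact constCoeff_heis_neg _ (by omega) _ _

lemma expAnnih_zero (α : Lat ℓ) : expAnnih α 0 = 1 := by
  have := expAnnih_neg_natCast α 0
  rwa [annihCoeff_zero] at this

lemma expCreate_zero (α : Lat ℓ) : expCreate α 0 = 1 := by
  have := expCreate_natCast α 0
  rwa [createCoeff_zero] at this

lemma constCoeff_expCreate (α : Lat ℓ) (n : ℤ) (γ : Lat ℓ) (x : Space ℓ) :
    constCoeff γ (expCreate α n x) = if n = 0 then constCoeff γ x else 0 := by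
  split_ifs with hn
  · rw [hn, expCreate_zero, Module.End.one_apply]
  · rcases lt_or_ge n 0 with h | h
    · rw [expCreate_of_neg α h, LinearMap.zero_apply, map_zero]
    · lift n to ℕ using h
      rw [expCreate_natCast, constCoeff_createCoeff α (by simpa using hn)]

/-- Creation operators do not contribute to constant coefficients. -/
lemma constCoeff_expPart (α : Lat ℓ) (n : ℤ) (γ : Lat ℓ) (x : Space ℓ) :
    constCoeff γ (expPart α n x) = constCoeff γ (expAnnih α n x) := by
  have h1 := (constCoeff γ).toAddMonoidHom.map_finsum (locFin_exp α n x)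
  unfold expPart mulD
  rw [locSum_apply (locFin_exp α n)]
  refine h1.trans ?_
  refine (finsum_eq_single _ 0 fun k hk => ?_).trans ?_
  · change constCoeff γ (expCreate α k _) = 0
    rw [constCoeff_expCreate, if_neg hk]
  · change constCoeff γ (expCreate α 0 _) = _
    rw [constCoeff_expCreate, if_pos rfl, sub_zero]

lemma expPart_single_one (α : Lat ℓ) (n : ℤ) (γ : Lat ℓ) :
    expPart α n (Finsupp.single γ 1) = expCreate α n (Finsupp.single γ 1) := by
  unfold expPart mulD
  rw [locSum_apply_eq_single (locFin_exp α n) _ n, sub_self, expAnnih_zero, mul_one]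
  intro k hk
  rw [Module.End.mul_apply]
  exact (congrArg _ (expAnnih_single_C α (by omega) γ 1)).trans (map_zero _)

/-- The coefficient of `x^n` in `(1 - x)^c`, extended by zero to negative `n`. -/
noncomputable def binomCoeff (c : ℂ) : ℤ → ℂ
  | Int.ofNat n => ∏ i ∈ Finset.range n, ((i : ℂ) - c) / ((i : ℂ) + 1)
  | Int.negSucc _ => 0

lemma binomCoeff_zero (c : ℂ) : binomCoeff c 0 = 1 := by
  change binomCoeff c (Int.ofNat 0) = 1
  simp [binomCoeff]

lemma binomCoeff_of_neg (c : ℂ) {n : ℤ} (hn : n < 0) : binomCoeff c n = 0 := by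
  obtain ⟨n, rfl⟩ := Int.eq_negSucc_of_lt_zero hn
  rfl

lemma binomCoeff_succ (c : ℂ) (n : ℕ) :
    binomCoeff c ((n + 1 : ℕ) : ℤ) = binomCoeff c (n : ℤ) * (((n : ℂ) - c) / ((n : ℂ) + 1)) :=
  Finset.prod_range_succ _ _

lemma binomCoeff_euler (c : ℂ) (n : ℕ) :
    (n : ℂ) * binomCoeff c (n : ℤ) = -c * ∑ i ∈ Finset.range n, binomCoeff c (i : ℤ) := by
  induction n with
  | zero => simp
  | succ n ih =>
    have h : ((n : ℂ) + 1) ≠ 0 := Nat.cast_add_one_ne_zero n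
    rw [Finset.sum_range_succ, mul_add, ← ih, binomCoeff_succ]
    push_cast
    field_simp
    ring

/-- The exponentials satisfy `B(z) C(w) = (1 - w/z)^{(α|β)} C(w) B(z)`, here in the form of
constant coefficients. -/
lemma constCoeff_annihCoeff_expCreate (α β γ δ : Lat ℓ) (n : ℕ) (m : ℤ) :
    constCoeff δ (annihCoeff α n (expCreate β m (Finsupp.single γ 1))) =
      if δ = γ ∧ m = n then binomCoeff (toCartan α ⬝ᵥ toCartan β) n else 0 := by
  induction n using Nat.strong_induction_on generalizing m with
  | _ n ih =>
  rcases Nat.eq_zero_or_pos n with rfl | hn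
  · rw [annihCoeff_zero, Module.End.one_apply, constCoeff_expCreate, constCoeff_single]
    have : binomCoeff (toCartan α ⬝ᵥ toCartan β) ((0 : ℕ) : ℤ) = 1 := binomCoeff_zero _
    rw [this]
    by_cases h1 : δ = γ <;> by_cases h2 : m = 0 <;> simp [h1, h2]
  set c := toCartan α ⬝ᵥ toCartan β
  have hn' : (n : ℂ) ≠ 0 := by exact_mod_cast hn.ne'
  have h2 := congrArg (fun T : Module.End ℂ (Space ℓ) =>
    constCoeff δ (T (expCreate β m (Finsupp.single γ 1)))) (annihCoeff_euler α n)
  simp only [LinearMap.smul_apply, LinearMap.sum_apply, map_smul, map_sum] at h2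
  have hterm : ∀ p ∈ Finset.HasAntidiagonal.antidiagonal n,
      constCoeff δ ((if p.1 = 0 then (0 : Module.End ℂ (Space ℓ))
        else -(annihCoeff α p.2 * heis (toCartan α) (p.1 : ℤ)))
          (expCreate β m (Finsupp.single γ 1))) =
      if p.1 = 0 then 0 else -c * (if δ = γ ∧ m = n then binomCoeff c (p.2 : ℤ) else 0) := by
    intro p hp
    have hp' := Finset.HasAntidiagonal.mem_antidiagonal.1 hp
    split_ifs with h0 h1
    · exact map_zero _
    all_goals
      have h3 : heis (toCartan α) (p.1 : ℤ) (expCreate β m (Finsupp.single γ 1)) =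
          c • expCreate β (m - p.1) (Finsupp.single γ 1) := by
        have hpos : (0 : ℤ) < p.1 := by omega
        have h4 := congrArg (fun T : Module.End ℂ (Space ℓ) => T (Finsupp.single γ 1))
          (comm_heis_expCreate (toCartan α) β (p.1 : ℤ) m)
        have h5 : heis (toCartan α) (p.1 : ℤ) (Finsupp.single γ (1 : Sym ℓ)) = 0 :=
          heis_single_C _ hpos γ 1
        simp only [comm, if_pos hpos, LinearMap.sub_apply, Module.End.mul_apply,
          LinearMap.smul_apply, h5, map_zero, sub_zero] at h4
        exact h4
      rw [LinearMap.neg_apply, Module.End.mul_apply, h3, map_smul, map_neg, map_smul,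
        ih p.2 (by omega), smul_eq_mul]
    · rw [if_pos ⟨h1.1, by omega⟩, neg_mul]
    · rw [if_neg (fun h => h1 ⟨h.1, by omega⟩), mul_zero, mul_zero, neg_zero]
  rw [Finset.sum_congr rfl hterm] at h2
  refine mul_left_cancel₀ hn' (h2.trans ?_)
  split_ifs with h1
  · rw [binomCoeff_euler]
    obtain ⟨n, rfl⟩ : ∃ k, n = k + 1 := ⟨n - 1, by omega⟩
    rw [Finset.Nat.sum_antidiagonal_succ]
    simp only [Nat.add_one_ne_zero, if_true, if_false, zero_add, ← Finset.mul_sum]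
    rw [← Finset.Nat.sum_antidiagonal_swap]
    exact congrArg _ (Finset.Nat.sum_antidiagonal_eq_sum_range_succ
      (fun i _ => binomCoeff c (i : ℤ)) n)
  · simp

lemma constCoeff_expAnnih_expCreate (α β γ δ : Lat ℓ) (n m : ℤ) :
    constCoeff δ (expAnnih α n (expCreate β m (Finsupp.single γ 1))) =
      if δ = γ ∧ n + m = 0 then binomCoeff (toCartan α ⬝ᵥ toCartan β) m else 0 := by
  rcases lt_or_ge 0 n with hn | hn
  · rw [expAnnih_of_pos α hn, LinearMap.zero_apply, map_zero]
    split_ifs with h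
    · rw [binomCoeff_of_neg _ (by omega)]
    · rfl
  · obtain ⟨n, rfl⟩ := Int.exists_eq_neg_ofNat hn
    rw [expAnnih_neg_natCast, constCoeff_annihCoeff_expCreate]
    have : (δ = γ ∧ -(n : ℤ) + m = 0) ↔ (δ = γ ∧ m = n) :=
      and_congr_right fun _ => by omega
    simp only [this]
    split_ifs with h
    · rw [h.2]
    · rfl

lemma expOp_expCreate (α β : Lat ℓ) (n : ℤ) (γ : Lat ℓ) :
    expOp α (expCreate β n (Finsupp.single γ 1)) =
      (((eps α γ : ℤˣ) : ℤ) : ℂ) • expCreate β n (Finsupp.single (α + γ) 1) := by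
  rcases lt_or_ge n 0 with hn | hn
  · rw [expCreate_of_neg β hn, LinearMap.zero_apply, LinearMap.zero_apply, map_zero, smul_zero]
  lift n to ℕ using hn
  have h1 : comm (expOp α) (createCoeff β n) = 0 :=
    comm_coeff_expSeries_eq_zero (comm_coeff_createSeries β fun k hk => comm_eq_zero_symm (by
      rw [comm_heis_expOp, if_neg (by omega)])) _
  have h2 := congrArg (fun T : Module.End ℂ (Space ℓ) => T (Finsupp.single γ 1)) (sub_eq_zero.1 h1)
  simp only [Module.End.mul_apply, expOp_single, map_smul] at h2
  rw [expCreate_natCast]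
  exact h2

lemma constCoeff_expOp (α γ : Lat ℓ) (x : Space ℓ) :
    constCoeff (α + γ) (expOp α x) = (((eps α γ : ℤˣ) : ℤ) : ℂ) * constCoeff γ x := by
  induction x using Finsupp.induction_linear with
  | zero => simp
  | add x y hx hy => rw [map_add, map_add, hx, hy, map_add, mul_add]
  | single δ p =>
    rw [expOp_single, map_smul, constCoeff_single, constCoeff_single, smul_eq_mul]
    by_cases h : γ = δ
    · rw [h]; simp
    · simp [h]

lemma latForm_add_right (α β γ : Lat ℓ) : latForm α (β + γ) = latForm α β + latForm α γ := by
  simp [latForm, mul_add, Finset.sum_add_distrib]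

lemma toCartan_dotProduct (α β : Lat ℓ) : toCartan α ⬝ᵥ toCartan β = (latForm α β : ℂ) := by
  simp [toCartan, latForm, dotProduct]

lemma vertexOp_single_one (α : Lat ℓ) (n : ℤ) (γ : Lat ℓ) :
    vertexOp α n (Finsupp.single γ 1) =
      (((eps α γ : ℤˣ) : ℤ) : ℂ) • expCreate α (n - latForm α γ) (Finsupp.single (α + γ) 1) := by
  rw [vertexOp_apply n fun k => zPow_single α γ k 1, expPart_single_one, expOp_expCreate]

lemma constCoeff_vertexOp (α γ δ : Lat ℓ) (n : ℤ) :
    constCoeff δ (vertexOp α n (Finsupp.single γ 1)) =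
      if δ = α + γ ∧ n = latForm α γ then (((eps α γ : ℤˣ) : ℤ) : ℂ) else 0 := by
  rw [vertexOp_single_one, map_smul, constCoeff_expCreate, constCoeff_single, smul_eq_mul]
  by_cases h1 : δ = α + γ <;> by_cases h2 : n = latForm α γ <;> simp [h1, h2, sub_eq_zero]

lemma vertexOp_expCreate (α β : Lat ℓ) (m n : ℤ) (γ : Lat ℓ) :
    vertexOp α m (expCreate β n (Finsupp.single γ 1)) =
      expOp α (expPart α (m - latForm α γ) (expCreate β n (Finsupp.single γ 1))) := by
  refine vertexOp_apply m fun k => ?_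
  have h1 := congrArg (fun T : Module.End ℂ (Space ℓ) => T (Finsupp.single γ 1))
    (sub_eq_zero.1 (comm_zPow_expCreate α β k n))
  simp only [Module.End.mul_apply, zPow_single] at h1
  rw [h1]
  split_ifs
  · rfl
  · exact map_zero _

/-- The constant coefficients of `E^α(z) E^β(w) (1 ⊗ e^γ)`: up to a sign and a monomial, the
expansion of `(1 - w/z)^{(α|β)}` in powers of `w/z`. -/
lemma constCoeff_vertexOp_vertexOp (α β γ δ : Lat ℓ) (a b : ℤ) :
    constCoeff δ (vertexOp α a (vertexOp β b (Finsupp.single γ 1))) =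
      if δ = α + (β + γ) ∧ a + b = latForm α β + latForm α γ + latForm β γ then
        (((eps α (β + γ) * eps β γ : ℤˣ) : ℤ) : ℂ) *
          binomCoeff (latForm α β) (b - latForm β γ) else 0 := by
  obtain ⟨δ, rfl⟩ : ∃ δ', δ = α + δ' := ⟨δ - α, by abel⟩
  rw [vertexOp_single_one, map_smul, vertexOp_expCreate, map_smul, constCoeff_expOp,
    constCoeff_expPart, constCoeff_expAnnih_expCreate, latForm_add_right, toCartan_dotProduct]
  have h : (δ = β + γ ∧ a - (latForm α β + latForm α γ) + (b - latForm β γ) = 0) ↔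
      (α + δ = α + (β + γ) ∧ a + b = latForm α β + latForm α γ + latForm β γ) := by
    rw [add_right_inj]
    exact and_congr_right fun _ => by omega
  simp only [h]
  split_ifs with h1
  · have hδ : δ = β + γ := add_left_cancel h1.1
    rw [hδ, smul_eq_mul]
    push_cast
    ring
  · simp

/-! ### Commutators of vertex operators -/

lemma eps_add_left (α β γ : Lat ℓ) : eps (α + β) γ = eps α γ * eps β γ := by
  simp only [eps, ← Finset.prod_mul_distrib, Pi.add_apply, add_mul, zpow_add]

lemma eps_add_right (α β γ : Lat ℓ) : eps α (β + γ) = eps α β * eps α γ := by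
  simp only [eps, ← Finset.prod_mul_distrib, Pi.add_apply, mul_add, zpow_add]

lemma eps_zero_left (γ : Lat ℓ) : eps 0 γ = 1 := by simp [eps]

lemma eps_zero_right (γ : Lat ℓ) : eps γ 0 = 1 := by simp [eps]

lemma latForm_comm (α β : Lat ℓ) : latForm α β = latForm β α := by
  simp [latForm, mul_comm]

lemma latForm_add_left (α β γ : Lat ℓ) : latForm (α + β) γ = latForm α γ + latForm β γ := by
  rw [latForm_comm, latForm_add_right, latForm_comm γ, latForm_comm γ]

lemma comm_heis_comm_vertexOp (h : Cartan ℓ) (α β : Lat ℓ) (k a b : ℤ) :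
    comm (heis h k) (comm (vertexOp α a) (vertexOp β b)) =
      (h ⬝ᵥ toCartan α) • comm (vertexOp α (a - k)) (vertexOp β b) +
        (h ⬝ᵥ toCartan β) • comm (vertexOp α a) (vertexOp β (b - k)) := by
  rw [comm_comm, comm_heis_vertexOp, comm_heis_vertexOp, comm_smul_left, comm_smul]

/-- The constant coefficients of `[E^α(z), E^β(w)] (1 ⊗ e^γ)`: the difference of the expansions of
`(z - w)^{(α|β)}` for `|w| < |z|` and for `|z| < |w|`. -/
lemma constCoeff_comm_vertexOp {α β : Lat ℓ} {s : ℤˣ} (hs : eps β α = s * eps α β)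
    (γ δ : Lat ℓ) (a b : ℤ) :
    constCoeff δ (comm (vertexOp α a) (vertexOp β b) (Finsupp.single γ 1)) =
      if δ = α + (β + γ) ∧ a + b = latForm α β + latForm α γ + latForm β γ then
        (((eps α β * eps α γ * eps β γ : ℤˣ) : ℤ) : ℂ) *
          (binomCoeff (latForm α β) (b - latForm β γ) -
            ((s : ℤ) : ℂ) * binomCoeff (latForm α β) (latForm α β - (b - latForm β γ)))
        else 0 := by
  rw [comm, LinearMap.sub_apply, map_sub, Module.End.mul_apply, Module.End.mul_apply,
    constCoeff_vertexOp_vertexOp, constCoeff_vertexOp_vertexOp, latForm_comm β α,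
    add_left_comm β α γ, add_comm b a, add_right_comm (latForm α β)]
  split_ifs with h
  · rw [eps_add_right, eps_add_right, hs,
      show a - latForm α γ = latForm α β - (b - latForm β γ) by omega]
    push_cast
    ring
  · exact sub_zero 0

lemma binomCoeff_natCast_of_lt (c : ℕ) {n : ℤ} (hn : (c : ℤ) < n) :
    binomCoeff (c : ℂ) n = 0 := by
  lift n to ℕ using by omega
  exact Finset.prod_eq_zero (Finset.mem_range.2 (by omega : c < n)) (by simp)

lemma binomCoeff_symm_of_le_two (c : ℕ) (hc : c ≤ 2) (n : ℤ) :
    binomCoeff (c : ℂ) n = (-1) ^ c * binomCoeff (c : ℂ) (c - n) := by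
  by_cases h0 : n < 0
  · rw [binomCoeff_of_neg _ h0, binomCoeff_natCast_of_lt c (by omega), mul_zero]
  by_cases h1 : (c : ℤ) < n
  · rw [binomCoeff_of_neg _ (show (c : ℤ) - n < 0 by omega), binomCoeff_natCast_of_lt c h1,
      mul_zero]
  have e1 : binomCoeff (c : ℂ) 1 = -c := by
    have := binomCoeff_succ (c : ℂ) 0
    simpa [binomCoeff_zero] using this
  have e2 : binomCoeff (c : ℂ) 2 = -c * (1 - c) / 2 := by
    have := binomCoeff_succ (c : ℂ) 1
    norm_num [e1] at this
    rw [this]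
    ring
  interval_cases c <;> interval_cases n <;> push_cast at e1 e2 <;>
    norm_num [e1, e2, binomCoeff_zero]

lemma binomCoeff_neg_one {n : ℤ} (hn : 0 ≤ n) : binomCoeff (-1) n = 1 := by
  lift n to ℕ using hn
  induction n with
  | zero => exact binomCoeff_zero _
  | succ n ih =>
    have : ((n : ℂ) + 1) ≠ 0 := Nat.cast_add_one_ne_zero n
    rw [binomCoeff_succ, ih, sub_neg_eq_add, div_self this, mul_one]

lemma binomCoeff_neg_two {n : ℤ} (hn : 0 ≤ n) : binomCoeff (-2) n = n + 1 := by
  lift n to ℕ using hn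
  induction n with
  | zero => exact (binomCoeff_zero _).trans (by simp)
  | succ n ih =>
    have : ((n : ℂ) + 1) ≠ 0 := Nat.cast_add_one_ne_zero n
    rw [binomCoeff_succ, ih]
    push_cast
    field_simp
    ring

/-- For `(α|β) ≥ 0` the vertex operators commute: `(z - w)^{(α|β)}` is a polynomial, which up to the
sign compensated by `ε` is symmetric. -/
theorem comm_vertexOp_of_nonneg {α β : Lat ℓ} (c : ℕ) (hc : latForm α β = c) (h2 : c ≤ 2)
    (hs : eps β α = (-1) ^ c * eps α β) (a b : ℤ) : comm (vertexOp α a) (vertexOp β b) = 0 := by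
  refine bilocal_eq_zero α β (fun a b => comm (vertexOp α a) (vertexOp β b))
    (fun h k a b => comm_heis_comm_vertexOp h α β k a b) (fun a b γ δ => ?_) a b
  rw [constCoeff_comm_vertexOp hs, hc]
  split_ifs
  · rw [Int.cast_natCast, binomCoeff_symm_of_le_two c h2 (b - latForm β γ)]
    push_cast
    rw [sub_self, mul_zero]
  · rfl

/-- For `(α|β) = -1` the commutator `[E^α(z), E^β(w)]` is `ε(α,β) E^{α+β}(w) δ(z-w)`. -/
theorem comm_vertexOp_of_eq_neg_one {α β : Lat ℓ} (hc : latForm α β = -1)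
    (hs : eps β α = -1 * eps α β) (a b : ℤ) : comm (vertexOp α a) (vertexOp β b) =
      (((eps α β : ℤˣ) : ℤ) : ℂ) • vertexOp (α + β) (a + b + 1) := by
  rw [← sub_eq_zero]
  refine bilocal_eq_zero α β (fun a b => comm (vertexOp α a) (vertexOp β b) -
    (((eps α β : ℤˣ) : ℤ) : ℂ) • vertexOp (α + β) (a + b + 1)) (fun h k a b => ?_)
    (fun a b γ δ => ?_) a b
  · rw [comm_sub, comm_heis_comm_vertexOp, comm_smul, comm_heis_vertexOp, toCartan_add,
      dotProduct_add, show a - k + b + 1 = a + b + 1 - k by ring,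
      show a + (b - k) + 1 = a + b + 1 - k by ring]
    module
  · rw [LinearMap.sub_apply, map_sub, constCoeff_comm_vertexOp hs, LinearMap.smul_apply, map_smul,
      constCoeff_vertexOp, latForm_add_left, hc, add_assoc α β γ]
    have h : a + b + 1 = latForm α γ + latForm β γ ↔
        a + b = -1 + latForm α γ + latForm β γ := by omega
    simp only [h]
    split_ifs with h1
    · -- The two expansions of `(z - w)⁻¹` have disjoint supports and add up to `δ(z-w)`.
      have h2 : binomCoeff (((-1 : ℤ) : ℂ)) (b - latForm β γ) - ((((-1 : ℤˣ) : ℤ) : ℂ)) *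
          binomCoeff (((-1 : ℤ) : ℂ)) (-1 - (b - latForm β γ)) = 1 := by
        push_cast
        rcases lt_or_ge (b - latForm β γ) 0 with h3 | h3
        · rw [binomCoeff_of_neg _ h3, binomCoeff_neg_one (by omega)]
          norm_num
        · rw [binomCoeff_neg_one h3, binomCoeff_of_neg _ (by omega)]
          norm_num
      rw [h2, eps_add_left, smul_eq_mul]
      push_cast
      ring
    · simp

/-- For `β = -α` and `(α|α) = 2` the commutator `[E^α(z), E^β(w)]` is
`ε(α,β) (α(w) δ(z-w) + ∂_w δ(z-w))`. -/
theorem comm_vertexOp_neg {α β : Lat ℓ} (hαβ : α + β = 0) (hc : latForm α β = -2)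
    (hs : eps β α = 1 * eps α β) (a b : ℤ) : comm (vertexOp α a) (vertexOp β b) =
      (((eps α β : ℤˣ) : ℤ) : ℂ) • (heis (toCartan α) (-(a + b) - 2) +
        (if a + b = -2 then -(a : ℂ) - 1 else 0) • (1 : Module.End ℂ (Space ℓ))) := by
  have hβ : toCartan β = -toCartan α := by
    refine eq_neg_of_add_eq_zero_right ?_
    rw [← toCartan_add, hαβ]
    ext i
    simp [toCartan]
  rw [← sub_eq_zero]
  refine bilocal_eq_zero α β (fun a b => comm (vertexOp α a) (vertexOp β b) -
    (((eps α β : ℤˣ) : ℤ) : ℂ) • (heis (toCartan α) (-(a + b) - 2) +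
        (if a + b = -2 then -(a : ℂ) - 1 else 0) • (1 : Module.End ℂ (Space ℓ))))
    (fun h k a b => ?_) (fun a b γ δ => ?_) a b
  · rw [comm_sub, comm_heis_comm_vertexOp, comm_smul, comm_add, comm_smul_one, comm_heis, hβ,
      dotProduct_neg, show -(a - k + b) - 2 = -(a + b) - 2 + k by ring,
      show -(a + (b - k)) - 2 = -(a + b) - 2 + k by ring]
    by_cases hk : k = a + b + 2
    · rw [if_pos (by omega), if_pos (by omega), if_pos (by omega)]
      push_cast
      module
    · rw [if_neg (by omega), if_neg (by omega), if_neg (by omega)]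
      module
  · have hβγ : latForm β γ = -latForm α γ := by
      have : latForm (α + β) γ = 0 := by rw [hαβ]; simp [latForm]
      rw [latForm_add_left] at this
      omega
    have hε : eps α γ * eps β γ = 1 := by rw [← eps_add_left, hαβ, eps_zero_left]
    rw [LinearMap.sub_apply, map_sub, constCoeff_comm_vertexOp hs, LinearMap.smul_apply, map_smul,
      LinearMap.add_apply, LinearMap.smul_apply, Module.End.one_apply, map_add, map_smul,
      constCoeff_single, hc, hβγ, ← add_assoc α β γ, hαβ, zero_add, add_neg_cancel_right, mul_assoc,
      hε, mul_one, MvPolynomial.coeff_zero_one]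
    have h1 : constCoeff δ (heis (toCartan α) (-(a + b) - 2) (Finsupp.single γ 1)) =
        if δ = γ ∧ a + b = -2 then (latForm α γ : ℂ) else 0 := by
      rcases lt_trichotomy (-(a + b) - 2) 0 with h | h | h
      · rw [constCoeff_heis_neg _ h, if_neg (by omega)]
      · rw [h, heis_zero_single, map_smul, constCoeff_single, toCartan_dotProduct]
        have : a + b = -2 := by omega
        simp [this]
      · have h2 : heis (toCartan α) (-(a + b) - 2) (Finsupp.single γ (1 : Sym ℓ)) = 0 :=
          heis_single_C _ h γ 1
        rw [h2, map_zero, if_neg (by omega)]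
    rw [h1]
    by_cases hδ : δ = γ
    · by_cases hab : a + b = -2
      · -- The two expansions of `(z - w)⁻²` have disjoint supports, and their difference has the
        -- coefficient `n + 1` in every degree `n`.
        have h2 : binomCoeff (((-2 : ℤ) : ℂ)) (b - -latForm α γ) - ((((1 : ℤˣ) : ℤ) : ℂ)) *
            binomCoeff (((-2 : ℤ) : ℂ)) (-2 - (b - -latForm α γ)) = b + latForm α γ + 1 := by
          push_cast
          rcases lt_or_ge (b - -latForm α γ) 0 with h3 | h3
          · rw [binomCoeff_of_neg _ h3]
            rcases eq_or_lt_of_le (Int.le_sub_one_of_lt h3) with h4 | h4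
            · rw [binomCoeff_of_neg _ (by omega)]
              have : b = -1 - latForm α γ := by omega
              rw [this]
              push_cast
              ring
            · rw [binomCoeff_neg_two (by omega)]
              push_cast
              ring
          · rw [binomCoeff_neg_two h3, binomCoeff_of_neg _ (by omega)]
            push_cast
            ring
        have hb : (b : ℂ) = -2 - a := by
          have : b = -2 - a := by omega
          rw [this]
          push_cast
          ring
        simp only [hδ, hab, and_self, if_true]
        rw [h2, hb, smul_eq_mul, smul_eq_mul]
        ring
      · simp [hab]
    · simp [hδ]

/-! ### The fields of the states in question -/

lemma Y_monomial (α : Lat ℓ) (d : Fin ℓ × ℕ →₀ ℕ) :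
    Y (Finsupp.single α (MvPolynomial.monomial d 1)) =
      monomialField α (Finsupp.toMultiset d).toList := by
  have h : MvPolynomial.monomial d (1 : ℂ) = MvPolynomial.basisMonomials (Fin ℓ × ℕ) ℂ d := by
    rw [MvPolynomial.coe_basisMonomials]
  rw [Y, Finsupp.lsum_single, h, Module.Basis.constr_basis]

lemma mode_expVec (α : Lat ℓ) (m : ℤ) : mode (expVec α) m = vertexOp α (-m - 1) := by
  have h := Y_monomial α 0
  rw [map_zero, Multiset.toList_zero] at h
  exact congrFun h (-m - 1)

lemma heis_eq_sum (h : Cartan ℓ) (m : ℤ) : heis h m = ∑ i, h i • heis (toCartan (v i)) m := by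
  have hv : ∀ i : Fin ℓ, toCartan (v i) = Pi.single i 1 := by
    intro i
    ext j
    simp [toCartan, v, Pi.single_apply]
  simp only [hv]
  refine space_ext fun γ p => ?_
  rw [LinearMap.sum_apply]
  simp only [LinearMap.smul_apply]
  rcases m with (_ | k) | k
  · change heis h 0 _ = ∑ i, h i • heis (Pi.single i 1) 0 _
    simp only [heis_zero_single, single_one_dotProduct, smul_smul]
    rw [← Finset.sum_smul]
    rfl
  · simp only [heis_succ_single, annihilator_apply, Finsupp.smul_single]
    rw [← Finsupp.single_finsetSum, Finset.smul_sum]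
    refine congrArg _ (Finset.sum_congr rfl fun i _ => ?_)
    rw [Finset.sum_eq_single i (fun j _ hj => by simp [hj]) (by simp), Pi.single_eq_same, one_smul,
      smul_comm]
  · simp only [heis_negSucc_single, creator_single, Finsupp.smul_single]
    rw [← Finsupp.single_finsetSum, creator, Finset.sum_mul]
    simp only [smul_mul_assoc]

/-- The vacuum field is the identity. -/
lemma vertexOp_zero (n : ℤ) : vertexOp (0 : Lat ℓ) n = if n = 0 then 1 else 0 := by
  have hz : toCartan (0 : Lat ℓ) = 0 := by
    ext i
    simp [toCartan]
  have h := bilocal_eq_zero (0 : Lat ℓ) 0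
    (fun a _ => vertexOp (0 : Lat ℓ) a - (if a = 0 then (1 : ℂ) else 0) • 1)
    (fun h k a b => by
      rw [comm_sub, comm_heis_vertexOp, comm_smul_one, hz, dotProduct_zero]
      simp)
    (fun a b γ δ => by
      have hf : latForm (0 : Lat ℓ) γ = 0 := by simp [latForm]
      rw [LinearMap.sub_apply, map_sub, constCoeff_vertexOp, LinearMap.smul_apply,
        Module.End.one_apply, map_smul, constCoeff_single, zero_add, hf, eps_zero_left]
      by_cases h1 : δ = γ <;> by_cases h2 : a = 0 <;> simp [h1, h2]) n 0
  refine (sub_eq_zero.1 h).trans ?_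
  rw [ite_smul, one_smul, zero_smul]

lemma mode_cartanState (h : Cartan ℓ) (m : ℤ) : mode (cartanState h) m = heis h m := by
  have key : ∀ i : Fin ℓ, Y (Finsupp.single 0 (MvPolynomial.X (i, 0) : Sym ℓ)) (-m - 1) =
      heis (toCartan (v i)) m := by
    intro i
    have h1 := Y_monomial (0 : Lat ℓ) (Finsupp.single (i, 0) 1)
    rw [Finsupp.toMultiset_single, one_nsmul, Multiset.toList_singleton] at h1
    refine (congrFun h1 (-m - 1)).trans ?_
    set A : Distr ℓ := ((Nat.factorial 0 : ℂ)⁻¹) • derivD^[0] (current (toCartan (v i))) with hA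
    change locSum (fun k => nonnegD A k * vertexOp 0 (-m - 1 - k)) +
      locSum (fun k => vertexOp 0 k * negD A (-m - 1 - k)) = _
    rw [locSum_eq_single (-m - 1), locSum_eq_single 0]
    · rw [sub_self, sub_zero, vertexOp_zero, if_pos rfl, mul_one, one_mul]
      have hA' : A (-m - 1) = heis (toCartan (v i)) m := by
        rw [hA]
        simp [current]
      unfold nonnegD negD
      rw [← hA']
      split_ifs
      · omega
      · rw [add_zero]
      · rw [zero_add]
      · omega
    · intro k hk
      rw [vertexOp_zero, if_neg hk, zero_mul]
    · intro k hk
      rw [vertexOp_zero, if_neg (by omega), mul_zero]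
  unfold mode
  rw [cartanState_eq, heis_eq_sum h m, Finsupp.single_finsetSum, map_sum, Finset.sum_apply]
  refine Finset.sum_congr rfl fun i _ => ?_
  rw [← Finsupp.smul_single, map_smul, Pi.smul_apply, key]

/-! ### The commutation relations of `𝔤𝔩_ℓ` at level one -/

/-- The modes of the states `matrixState X`, for all matrices `X ∈ 𝔤𝔩_ℓ`. -/
noncomputable def glMode (m : ℤ) : Matrix (Fin ℓ) (Fin ℓ) ℂ →ₗ[ℂ] Module.End ℂ (Space ℓ) :=
  LinearMap.proj (-m - 1) ∘ₗ Y ∘ₗ matrixState ℓ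

lemma glMode_apply (m : ℤ) (X : Matrix (Fin ℓ) (Fin ℓ) ℂ) :
    glMode m X = mode (matrixState ℓ X) m := rfl

lemma glMode_diagonal (m : ℤ) (h : Cartan ℓ) : glMode m (Matrix.diagonal h) = heis h m := by
  rw [glMode_apply, matrixState_diagonal, mode_cartanState]

lemma glMode_single_self (m : ℤ) (k : Fin ℓ) :
    glMode m (Matrix.single k k 1) = heis (Pi.single k 1) m := by
  rw [← Matrix.diagonal_single, glMode_diagonal]

lemma glMode_single_ne (m : ℤ) {k l : Fin ℓ} (h : k ≠ l) :
    glMode m (Matrix.single k l 1) =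
      (((epsSign l k : ℤˣ) : ℤ) : ℂ) • vertexOp (v k - v l) (-m - 1) := by
  rw [glMode_apply, matrixState_single h, ← mode_expVec]
  unfold mode eState
  rw [map_smul, Pi.smul_apply]

lemma matrix_induction {motive : Matrix (Fin ℓ) (Fin ℓ) ℂ → Prop} (zero : motive 0)
    (add : ∀ X Z, motive X → motive Z → motive (X + Z))
    (smul : ∀ (c : ℂ) X, motive X → motive (c • X))
    (single : ∀ k l, motive (Matrix.single k l 1)) (X : Matrix (Fin ℓ) (Fin ℓ) ℂ) : motive X := by
  induction X using Matrix.induction_on' with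
  | h_zero => exact zero
  | h_add X Z hX hZ => exact add X Z hX hZ
  | h_std_basis k l c =>
    have := smul c _ (single k l)
    rwa [Matrix.smul_single, smul_eq_mul, mul_one] at this

/-- The relation `[X_{(m)}, Z_{(n)}] = [X, Z]_{(m+n)} + m δ_{m,-n} tr(X Z)` for all `m` and `n`. -/
def AffineRel (X Z : Matrix (Fin ℓ) (Fin ℓ) ℂ) : Prop :=
  ∀ m n : ℤ, comm (glMode m X) (glMode n Z) = glMode (m + n) (X * Z - Z * X) +
    (if m = -n then (m : ℂ) * (X * Z).trace else 0) • (1 : Module.End ℂ (Space ℓ))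

lemma AffineRel.symm {X Z : Matrix (Fin ℓ) (Fin ℓ) ℂ} (h : AffineRel X Z) : AffineRel Z X := by
  intro m n
  rw [← neg_comm, h n m, ← neg_sub (X * Z), map_neg, add_comm n m, Matrix.trace_mul_comm Z X]
  by_cases hmn : m = -n
  · rw [if_pos hmn, if_pos (by omega), hmn]
    push_cast
    module
  · rw [if_neg hmn, if_neg (by omega)]
    module

lemma AffineRel.add_right {X Z W : Matrix (Fin ℓ) (Fin ℓ) ℂ} (h : AffineRel X Z)
    (h' : AffineRel X W) : AffineRel X (Z + W) := by
  intro m n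
  rw [map_add, comm_add, h m n, h' m n, mul_add, add_mul, add_sub_add_comm, map_add,
    Matrix.trace_add]
  split_ifs <;> module

lemma AffineRel.smul_right {X Z : Matrix (Fin ℓ) (Fin ℓ) ℂ} (c : ℂ) (h : AffineRel X Z) :
    AffineRel X (c • Z) := by
  intro m n
  rw [map_smul, comm_smul, h m n, mul_smul_comm, smul_mul_assoc, ← smul_sub, map_smul,
    Matrix.trace_smul, smul_eq_mul]
  split_ifs <;> module

lemma AffineRel.zero_right (X : Matrix (Fin ℓ) (Fin ℓ) ℂ) : AffineRel X 0 := by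
  intro m n
  rw [map_zero, comm_zero, mul_zero, zero_mul, sub_zero, map_zero, Matrix.trace_zero, mul_zero,
    ite_self, zero_smul, add_zero]

lemma affineRel_diagonal_diagonal (h g : Cartan ℓ) :
    AffineRel (Matrix.diagonal h) (Matrix.diagonal g) := by
  intro m n
  rw [glMode_diagonal, glMode_diagonal, comm_heis, Matrix.diagonal_mul_diagonal,
    Matrix.diagonal_mul_diagonal]
  simp only [mul_comm (g _), sub_self, map_zero, zero_add, Matrix.trace_diagonal, ite_smul,
    zero_smul]
  rfl

lemma dotProduct_toCartan_v_sub_v (h : Cartan ℓ) (k l : Fin ℓ) :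
    h ⬝ᵥ toCartan (v k - v l) = h k - h l := by
  have : toCartan (v k - v l) = Pi.single k 1 - Pi.single l 1 := by
    ext j
    simp [toCartan, v, Pi.single_apply]
  rw [this, dotProduct_sub, dotProduct_single_one, dotProduct_single_one]

lemma affineRel_diagonal_single (h : Cartan ℓ) {k l : Fin ℓ} (hkl : k ≠ l) :
    AffineRel (Matrix.diagonal h) (Matrix.single k l 1) := by
  intro m n
  have h1 : Matrix.diagonal h * Matrix.single k l 1 = h k • Matrix.single k l (1 : ℂ) := by
    ext i j
    by_cases hi : k = i <;> simp [Matrix.diagonal_mul, Matrix.single_apply, hi]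
  have h2 : Matrix.single k l 1 * Matrix.diagonal h = h l • Matrix.single k l (1 : ℂ) := by
    ext i j
    by_cases hj : l = j <;> simp [Matrix.mul_diagonal, Matrix.single_apply, hj]
  rw [h1, h2, ← sub_smul, map_smul, glMode_diagonal, glMode_single_ne n hkl, comm_smul,
    comm_heis_vertexOp, dotProduct_toCartan_v_sub_v, glMode_single_ne _ hkl, Matrix.trace_smul,
    Matrix.trace_single_eq_of_ne _ _ _ hkl, smul_zero, mul_zero, ite_self, zero_smul, add_zero,
    smul_comm, show -n - 1 - m = -(m + n) - 1 by ring]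

lemma latForm_v_sub_v (k l p q : Fin ℓ) : latForm (v k - v l) (v p - v q) =
    (if k = p then 1 else 0) - (if k = q then 1 else 0) - (if l = p then 1 else 0) +
      (if l = q then 1 else 0) := by
  change (v k - v l) ⬝ᵥ (v p - v q) = _
  simp only [v, sub_dotProduct, single_one_dotProduct, Pi.sub_apply, Pi.single_apply]
  ring

lemma eps_v_v (i j : Fin ℓ) : eps (v i) (v j) = epsSign i j := by
  unfold eps
  rw [Finset.prod_eq_single i, Finset.prod_eq_single j]
  · simp [v]
  · intro k _ hk
    simp [v, hk]
  · simp
  · intro k _ hk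
    refine Finset.prod_eq_one fun _ _ => ?_
    simp [v, hk]
  · simp

lemma eps_sub_left (α β γ : Lat ℓ) : eps (α - β) γ = eps α γ * eps β γ := by
  have h := eps_add_left (α - β) β γ
  rw [sub_add_cancel] at h
  rw [h, mul_assoc, Int.units_mul_self, mul_one]

lemma eps_sub_right (α β γ : Lat ℓ) : eps α (β - γ) = eps α β * eps α γ := by
  have h := eps_add_right α (β - γ) γ
  rw [sub_add_cancel] at h
  rw [h, mul_assoc, Int.units_mul_self, mul_one]

lemma eps_v_sub_v (k l p q : Fin ℓ) : eps (v k - v l) (v p - v q) =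
    epsSign k p * epsSign k q * (epsSign l p * epsSign l q) := by
  simp only [eps_sub_left, eps_sub_right, eps_v_v]
  exact mul_mul_mul_comm _ _ _ _

lemma epsSign_swap (i j : Fin ℓ) : epsSign j i = (if i = j then 1 else -1) * epsSign i j := by
  unfold epsSign
  rcases lt_trichotomy i j with h | rfl | h
  · simp [h, h.not_gt, h.ne]
  · simp
  · simp [h, h.not_gt, h.ne']

/-- The sign in `E^α(z) E^β(w) ~ ± E^β(w) E^α(z)` for roots is `(-1)^{(α|β)}`, here written as a
product of signs, one for each pair of basis vectors. -/
lemma eps_v_sub_v_swap (k l p q : Fin ℓ) : eps (v p - v q) (v k - v l) =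
    ((if k = p then 1 else -1) * (if k = q then 1 else -1) *
      ((if l = p then 1 else -1) * (if l = q then 1 else -1))) * eps (v k - v l) (v p - v q) := by
  rw [eps_v_sub_v, eps_v_sub_v, epsSign_swap k p, epsSign_swap k q, epsSign_swap l p,
    epsSign_swap l q]
  ac_rfl

lemma epsSign_self (i : Fin ℓ) : epsSign i i = -1 := by simp [epsSign]

lemma affineRel_single_swap {k l : Fin ℓ} (hkl : k ≠ l) :
    AffineRel (Matrix.single k l (1 : ℂ)) (Matrix.single l k 1) := by
  intro m n
  have hα : (v k - v l) + (v l - v k) = (0 : Lat ℓ) := by abel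
  have hc : latForm (v k - v l) (v l - v k) = -2 := by
    rw [latForm_v_sub_v]
    simp [hkl, hkl.symm]
  have hs : eps (v l - v k) (v k - v l) = 1 * eps (v k - v l) (v l - v k) := by
    rw [eps_v_sub_v_swap k l l k]
    simp [hkl, hkl.symm]
  have hh : toCartan (v k - v l) = (Pi.single k 1 - Pi.single l 1 : Cartan ℓ) := by
    ext j
    simp [toCartan, v, Pi.single_apply]
  have hsign : epsSign l k * (epsSign k l * eps (v k - v l) (v l - v k)) = 1 := by
    rw [eps_v_sub_v, epsSign_self, epsSign_self, epsSign_swap k l, if_neg hkl]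
    rcases Int.units_eq_one_or (epsSign k l) with h | h <;> rw [h] <;> rfl
  rw [glMode_single_ne m hkl, glMode_single_ne n hkl.symm, comm_smul, comm_smul_left,
    comm_vertexOp_neg hα hc hs, Matrix.single_mul_single_same, Matrix.single_mul_single_same,
    smul_smul, smul_smul, mul_one, Matrix.trace_single_eq_same, ← Matrix.diagonal_single,
    ← Matrix.diagonal_single, Matrix.diagonal_sub, glMode_diagonal, hh]
  have hsign' : (((epsSign k l : ℤˣ) : ℤ) : ℂ) * (((epsSign l k : ℤˣ) : ℤ) : ℂ) *
      (((eps (v k - v l) (v l - v k) : ℤˣ) : ℤ) : ℂ) = 1 := by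
    have := congrArg (fun u : ℤˣ => ((u : ℤ) : ℂ)) hsign
    push_cast at this
    linear_combination this
  rw [hsign', one_smul, show -(-m - 1 + (-n - 1)) - 2 = m + n by ring]
  congr 2
  by_cases h : m = -n
  · rw [if_pos (by omega), if_pos h]
    push_cast
    ring
  · rw [if_neg (by omega), if_neg h]

lemma affineRel_single_trans {k l q : Fin ℓ} (hkl : k ≠ l) (hlq : l ≠ q) (hkq : k ≠ q) :
    AffineRel (Matrix.single k l (1 : ℂ)) (Matrix.single l q 1) := by
  intro m n
  have hc : latForm (v k - v l) (v l - v q) = -1 := by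
    rw [latForm_v_sub_v]
    simp [hkl, hkq, hlq]
  have hs : eps (v l - v q) (v k - v l) = -1 * eps (v k - v l) (v l - v q) := by
    rw [eps_v_sub_v_swap k l l q]
    simp [hkl, hkq, hlq]
  have hsign : epsSign q l * epsSign l k * eps (v k - v l) (v l - v q) = epsSign q k := by
    rw [eps_v_sub_v, epsSign_self, epsSign_swap k l, epsSign_swap l q, epsSign_swap k q, if_neg hkl,
      if_neg hlq, if_neg hkq]
    rcases Int.units_eq_one_or (epsSign k l) with h | h <;>
    rcases Int.units_eq_one_or (epsSign k q) with h' | h' <;>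
    rcases Int.units_eq_one_or (epsSign l q) with h'' | h'' <;> rw [h, h', h''] <;> rfl
  have hsign' : (((epsSign q l : ℤˣ) : ℤ) : ℂ) * (((epsSign l k : ℤˣ) : ℤ) : ℂ) *
      (((eps (v k - v l) (v l - v q) : ℤˣ) : ℤ) : ℂ) = (((epsSign q k : ℤˣ) : ℤ) : ℂ) := by
    rw [← hsign]
    push_cast
    rfl
  rw [glMode_single_ne m hkl, glMode_single_ne n hlq, comm_smul, comm_smul_left,
    comm_vertexOp_of_eq_neg_one hc hs, Matrix.single_mul_single_same,
    Matrix.single_mul_single_of_ne _ _ _ _ hkq.symm, sub_zero, mul_one, glMode_single_ne _ hkq,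
    Matrix.trace_single_eq_of_ne _ _ _ hkq, mul_zero, ite_self, zero_smul, add_zero, smul_smul,
    smul_smul, hsign', sub_add_sub_cancel, show -m - 1 + (-n - 1) + 1 = -(m + n) - 1 by ring]

lemma affineRel_single_of_ne {k l p q : Fin ℓ} (hkl : k ≠ l) (hpq : p ≠ q) (hlp : l ≠ p)
    (hkq : k ≠ q) : AffineRel (Matrix.single k l (1 : ℂ)) (Matrix.single p q 1) := by
  intro m n
  have h0 : comm (vertexOp (v k - v l) (-m - 1)) (vertexOp (v p - v q) (-n - 1)) = 0 := by
    have hc := latForm_v_sub_v k l p q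
    have hs := eps_v_sub_v_swap k l p q
    rw [if_neg hkq, if_neg hlp] at hc hs
    by_cases h1 : k = p <;> by_cases h2 : l = q
    · rw [if_pos h1, if_pos h2] at hc hs
      exact comm_vertexOp_of_nonneg 2 hc le_rfl hs _ _
    · rw [if_pos h1, if_neg h2] at hc hs
      exact comm_vertexOp_of_nonneg 1 hc one_le_two hs _ _
    · rw [if_neg h1, if_pos h2] at hc hs
      exact comm_vertexOp_of_nonneg 1 hc one_le_two hs _ _
    · rw [if_neg h1, if_neg h2] at hc hs
      exact comm_vertexOp_of_nonneg 0 hc zero_le_two hs _ _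
  rw [glMode_single_ne m hkl, glMode_single_ne n hpq, comm_smul, comm_smul_left, h0,
    Matrix.single_mul_single_of_ne _ _ _ _ hlp, Matrix.single_mul_single_of_ne _ _ _ _ hkq.symm,
    sub_zero, map_zero, Matrix.trace_zero, mul_zero, ite_self, zero_smul, add_zero, smul_zero,
    smul_zero]

lemma affineRel_single_single (k l p q : Fin ℓ) :
    AffineRel (Matrix.single k l (1 : ℂ)) (Matrix.single p q 1) := by
  by_cases hkl : k = l
  · subst hkl
    rw [← Matrix.diagonal_single]
    by_cases hpq : p = q
    · subst hpq
      rw [← Matrix.diagonal_single]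
      exact affineRel_diagonal_diagonal _ _
    · exact affineRel_diagonal_single _ hpq
  by_cases hpq : p = q
  · subst hpq
    rw [← Matrix.diagonal_single]
    exact (affineRel_diagonal_single _ hkl).symm
  by_cases hlp : l = p
  · subst hlp
    by_cases hkq : k = q
    · subst hkq
      exact affineRel_single_swap hkl
    · exact affineRel_single_trans hkl hpq hkq
  · by_cases hkq : k = q
    · subst hkq
      exact (affineRel_single_trans hpq hkl (Ne.symm hlp)).symm
    · exact affineRel_single_of_ne hkl hpq hlp hkq

/-- The modes of the states `matrixState X` form a representation of level one. -/
theorem affineRel (X Z : Matrix (Fin ℓ) (Fin ℓ) ℂ) : AffineRel X Z := by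
  induction X using matrix_induction with
  | zero => exact (AffineRel.zero_right Z).symm
  | add X X' h h' => exact (h.symm.add_right h'.symm).symm
  | smul c X h => exact (h.symm.smul_right c).symm
  | single k l =>
    induction Z using matrix_induction with
    | zero => exact AffineRel.zero_right _
    | add Z Z' h h' => exact h.add_right h'
    | smul c Z h => exact h.smul_right c
    | single p q => exact affineRel_single_single k l p q

/-! ### The state-field correspondence on the vacuum -/

lemma vertexOp_vac_of_neg (α : Lat ℓ) {n : ℤ} (hn : n < 0) : vertexOp α n (vac ℓ) = 0 := by
  unfold vac expVec
  have h0 : latForm α 0 = 0 := by simp [latForm]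
  rw [vertexOp_single_one, h0, expCreate_of_neg _ (by omega), LinearMap.zero_apply, smul_zero]

lemma vertexOp_zero_vac (α : Lat ℓ) : vertexOp α 0 (vac ℓ) = expVec α := by
  unfold vac expVec
  have h0 : latForm α 0 = 0 := by simp [latForm]
  rw [vertexOp_single_one, h0, sub_zero, expCreate_zero, eps_zero_right, add_zero,
    Module.End.one_apply, Units.val_one, Int.cast_one, one_smul]

lemma heis_vac_of_nonneg (h : Cartan ℓ) {m : ℤ} (hm : 0 ≤ m) : heis h m (vac ℓ) = 0 := by
  rcases hm.eq_or_lt with rfl | hm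
  · unfold vac expVec
    have : toCartan (0 : Lat ℓ) = 0 := by
      ext i
      simp [toCartan]
    rw [heis_zero_single, this, dotProduct_zero, zero_smul]
  · exact heis_single_C h hm 0 1

lemma glMode_vac_of_nonneg {m : ℤ} (hm : 0 ≤ m) (X : Matrix (Fin ℓ) (Fin ℓ) ℂ) :
    glMode m X (vac ℓ) = 0 := by
  induction X using matrix_induction with
  | zero => rw [map_zero, LinearMap.zero_apply]
  | add X X' h h' => rw [map_add, LinearMap.add_apply, h, h', add_zero]
  | smul c X h => rw [map_smul, LinearMap.smul_apply, h, smul_zero]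
  | single k l =>
    by_cases hkl : k = l
    · subst hkl
      rw [glMode_single_self, heis_vac_of_nonneg _ hm]
    · rw [glMode_single_ne m hkl, LinearMap.smul_apply, vertexOp_vac_of_neg _ (by omega), smul_zero]

lemma glMode_neg_one_vac (X : Matrix (Fin ℓ) (Fin ℓ) ℂ) :
    glMode (-1) X (vac ℓ) = matrixState ℓ X := by
  induction X using matrix_induction with
  | zero => rw [map_zero, LinearMap.zero_apply, map_zero]
  | add X X' h h' => rw [map_add, LinearMap.add_apply, h, h', map_add]
  | smul c X h => rw [map_smul, LinearMap.smul_apply, h, map_smul]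
  | single k l =>
    by_cases hkl : k = l
    · subst hkl
      rw [← Matrix.diagonal_single, matrixState_diagonal, glMode_diagonal, cartanState]
    · rw [glMode_single_ne _ hkl, matrixState_single hkl, LinearMap.smul_apply,
        show (-(-1) - 1 : ℤ) = 0 by norm_num, vertexOp_zero_vac, eState]

/-- The product `a_{(0)} b` of states is the commutator of matrices; this follows from the
commutation relations by evaluation on the vacuum. -/
theorem stateBracket_matrixState (X Z : Matrix (Fin ℓ) (Fin ℓ) ℂ) :
    stateBracket (matrixState ℓ X) (matrixState ℓ Z) = matrixState ℓ (X * Z - Z * X) := by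
  have h := congrArg (fun T : Module.End ℂ (Space ℓ) => T (vac ℓ)) (affineRel X Z 0 (-1))
  simp only [comm, LinearMap.sub_apply, LinearMap.add_apply, Module.End.mul_apply,
    LinearMap.smul_apply, glMode_vac_of_nonneg le_rfl, map_zero, sub_zero, zero_add,
    glMode_neg_one_vac] at h
  rw [if_neg (by norm_num), zero_smul, add_zero] at h
  exact h

/-- The vacuum-to-vacuum matrix coefficient of each mode vanishes. -/
lemma constCoeff_glMode_vac (m : ℤ) (X : Matrix (Fin ℓ) (Fin ℓ) ℂ) :
    constCoeff 0 (glMode m X (vac ℓ)) = 0 := by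
  induction X using matrix_induction with
  | zero => rw [map_zero, LinearMap.zero_apply, map_zero]
  | add X X' h h' => rw [map_add, LinearMap.add_apply, map_add, h, h', add_zero]
  | smul c X h => rw [map_smul, LinearMap.smul_apply, map_smul, h, smul_zero]
  | single k l =>
    by_cases hkl : k = l
    · subst hkl
      rw [glMode_single_self]
      rcases lt_or_ge m 0 with hm | hm
      · exact constCoeff_heis_neg _ hm _ _
      · rw [heis_vac_of_nonneg _ hm, map_zero]
    · unfold vac expVec
      rw [glMode_single_ne m hkl, LinearMap.smul_apply, map_smul, constCoeff_vertexOp, if_neg,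
        smul_zero]
      rw [add_zero]
      exact fun h => v_sub_v_ne_zero hkl h.1.symm

open scoped TensorProduct

/-! ### The representation of the affine Lie algebra -/

lemma loop_induction {motive : LieAlgebra.loopAlgebra ℂ ℤ (Sl ℓ) → Prop} (zero : motive 0)
    (add : ∀ s t, motive s → motive t → motive (s + t))
    (single : ∀ (m : ℤ) (X : Sl ℓ), motive (AddMonoidAlgebra.single m (1 : ℂ) ⊗ₜ[ℂ] X))
    (t : LieAlgebra.loopAlgebra ℂ ℤ (Sl ℓ)) : motive t := by
  obtain ⟨f, rfl⟩ := (LieAlgebra.LoopAlgebra.toFinsupp ℂ ℤ (Sl ℓ)).symm.surjective t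
  induction f using Finsupp.induction_linear with
  | zero => rwa [map_zero]
  | add f g hf hg => rw [map_add]; exact add _ _ hf hg
  | single m X =>
    rw [LieAlgebra.LoopAlgebra.toFinsupp_symm_single]
    exact single m X

/-- The linear map `X s^m ↦ X_{(m)}` on the loop algebra. -/
noncomputable def loopRep (ℓ : ℕ) :
    LieAlgebra.loopAlgebra ℂ ℤ (Sl ℓ) →ₗ[ℂ] Module.End ℂ (Space ℓ) :=
  Finsupp.lsum ℂ (fun m : ℤ =>
    glMode m ∘ₗ (LieAlgebra.SpecialLinear.sl (Fin ℓ) ℂ).toSubmodule.subtype) ∘ₗ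
    (LieAlgebra.LoopAlgebra.toFinsupp ℂ ℤ (Sl ℓ)).toLinearMap

lemma loopRep_single (m : ℤ) (X : Sl ℓ) :
    loopRep ℓ (AddMonoidAlgebra.single m (1 : ℂ) ⊗ₜ[ℂ] X) = glMode m X.1 := by
  rw [loopRep, LinearMap.comp_apply, LinearEquiv.coe_coe,
    LieAlgebra.LoopAlgebra.toFinsupp_single_tmul, Finsupp.lsum_single]
  rfl

/-- The cocycle of the affine Lie algebra with values in `ℂ`. -/
noncomputable def cocycleForm (ℓ : ℕ) :
    LieAlgebra.loopAlgebra ℂ ℤ (Sl ℓ) →ₗ[ℂ] LieAlgebra.loopAlgebra ℂ ℤ (Sl ℓ) →ₗ[ℂ] ℂ :=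
  (affineCocycle ℓ).1.1.compr₂
    (TrivialLieModule.equiv ℂ (LieAlgebra.loopAlgebra ℂ ℤ (Sl ℓ)) ℂ).toLinearMap

lemma cocycleForm_single (X Z : Sl ℓ) (m n : ℤ) :
    cocycleForm ℓ (AddMonoidAlgebra.single m (1 : ℂ) ⊗ₜ[ℂ] X)
      (AddMonoidAlgebra.single n (1 : ℂ) ⊗ₜ[ℂ] Z) =
      if m = -n then (m : ℂ) * Matrix.trace (X.1 * Z.1) else 0 := by
  have h := congrArg (TrivialLieModule.equiv ℂ (LieAlgebra.loopAlgebra ℂ ℤ (Sl ℓ)) ℂ)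
    (affineCocycle_apply X Z m n)
  rw [LinearEquiv.apply_symm_apply] at h
  exact h

/-- The bracket of the loop algebra as a bilinear map. -/
noncomputable abbrev loopBracket (ℓ : ℕ) : LieAlgebra.loopAlgebra ℂ ℤ (Sl ℓ) →ₗ[ℂ]
    LieAlgebra.loopAlgebra ℂ ℤ (Sl ℓ) →ₗ[ℂ] LieAlgebra.loopAlgebra ℂ ℤ (Sl ℓ) :=
  (LieAlgebra.ad ℂ (LieAlgebra.loopAlgebra ℂ ℤ (Sl ℓ)) : _ →ₗ[ℂ] _)

lemma loopBracket_single (X Z : Sl ℓ) (m n : ℤ) :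
    loopBracket ℓ (AddMonoidAlgebra.single m (1 : ℂ) ⊗ₜ[ℂ] X)
      (AddMonoidAlgebra.single n (1 : ℂ) ⊗ₜ[ℂ] Z) =
      AddMonoidAlgebra.single (m + n) (1 : ℂ) ⊗ₜ[ℂ] ⁅X, Z⁆ := by
  refine (LieAlgebra.ExtendScalars.bracket_tmul ℂ _ _ _ _ _ _ _).trans ?_
  rw [AddMonoidAlgebra.single_mul_single, mul_one]

lemma comm_loopRep (s t : LieAlgebra.loopAlgebra ℂ ℤ (Sl ℓ)) :
    comm (loopRep ℓ s) (loopRep ℓ t) =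
      loopRep ℓ (loopBracket ℓ s t) + cocycleForm ℓ s t • (1 : Module.End ℂ (Space ℓ)) := by
  induction s using loop_induction with
  | zero =>
    simp only [map_zero, LinearMap.zero_apply, zero_smul, add_zero]
    exact comm_eq_zero_symm (comm_zero _)
  | add s s' h h' =>
    have hadd : comm (loopRep ℓ (s + s')) (loopRep ℓ t) =
        comm (loopRep ℓ s) (loopRep ℓ t) + comm (loopRep ℓ s') (loopRep ℓ t) := by
      simp only [comm, map_add, add_mul, mul_add]
      abel
    rw [hadd, h, h', map_add (loopBracket ℓ), map_add (cocycleForm ℓ), LinearMap.add_apply,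
      LinearMap.add_apply, map_add]
    module
  | single m X =>
    induction t using loop_induction with
    | zero => simp only [map_zero, comm_zero, zero_smul, add_zero]
    | add t t' h h' =>
      rw [map_add, comm_add, h, h', map_add, map_add, map_add]
      module
    | single n Z =>
      rw [loopBracket_single, loopRep_single, loopRep_single, loopRep_single, affineRel,
        cocycleForm_single]
      rfl

/-- The level one representation of the affine Lie algebra, as a linear map. -/
noncomputable def affineRepLinear (ℓ : ℕ) : AffineSl ℓ →ₗ[ℂ] Module.End ℂ (Space ℓ) where
  toFun x := loopRep ℓ ((LieAlgebra.ofProd _).symm x).1 +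
    TrivialLieModule.equiv ℂ (LieAlgebra.loopAlgebra ℂ ℤ (Sl ℓ)) ℂ
      ((LieAlgebra.ofProd _).symm x).2 • 1
  map_add' x y := by
    rw [LieAlgebra.of_symm_add, Prod.fst_add, Prod.snd_add, map_add, map_add]
    module
  map_smul' c x := by
    rw [LieAlgebra.of_symm_smul, Prod.smul_fst, Prod.smul_snd, map_smul, map_smul, smul_eq_mul,
      RingHom.id_apply]
    module

/-- The level one representation of the affine Lie algebra. -/
noncomputable def affineRep (ℓ : ℕ) : AffineSl ℓ →ₗ⁅ℂ⁆ Module.End ℂ (Space ℓ) where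
  toLinearMap := affineRepLinear ℓ
  map_lie' := by
    intro x y
    have h1 : ∀ (t : LieAlgebra.loopAlgebra ℂ ℤ (Sl ℓ)) (c : ℂ) (T : Module.End ℂ (Space ℓ)),
        comm T (loopRep ℓ t + c • 1) = comm T (loopRep ℓ t) := fun t c T => by
      rw [comm_add, comm_smul_one, add_zero]
    set s := ((LieAlgebra.ofProd (affineCocycle ℓ)).symm x).1
    set t := ((LieAlgebra.ofProd (affineCocycle ℓ)).symm y).1
    change loopRep ℓ (loopBracket ℓ s t) +
      TrivialLieModule.equiv ℂ (LieAlgebra.loopAlgebra ℂ ℤ (Sl ℓ)) ℂ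
        ((LieAlgebra.ofProd (affineCocycle ℓ)).symm ⁅x, y⁆).2 • 1 =
      comm (loopRep ℓ s + _ • 1) (loopRep ℓ t + _ • 1)
    rw [h1, ← neg_comm, h1, neg_comm, comm_loopRep, LieAlgebra.bracket_ofTwoCocycle,
      Equiv.symm_apply_apply]
    simp only [trivial_lie_zero, add_zero, sub_zero]
    rfl

lemma affineRep_loopElt (X : Sl ℓ) (m : ℤ) : affineRep ℓ (loopElt X m) = glMode m X.1 := by
  change loopRep ℓ (AddMonoidAlgebra.single m (1 : ℂ) ⊗ₜ[ℂ] X) + (0 : ℂ) • 1 = _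
  rw [loopRep_single, zero_smul, add_zero]

lemma affineRep_centralElt : affineRep ℓ (centralElt ℓ) = 1 := by
  change loopRep ℓ 0 + (1 : ℂ) • 1 = _
  rw [map_zero, zero_add, one_smul]

/-! ### Faithfulness -/

lemma constCoeff_loopRep_vac (t : LieAlgebra.loopAlgebra ℂ ℤ (Sl ℓ)) :
    constCoeff 0 (loopRep ℓ t (vac ℓ)) = 0 := by
  induction t using loop_induction with
  | zero => rw [map_zero, LinearMap.zero_apply, map_zero]
  | add s t hs ht => rw [map_add, LinearMap.add_apply, map_add, hs, ht, add_zero]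
  | single m X => rw [loopRep_single, constCoeff_glMode_vac]

/-- The vacuum expectation value separates the scalars from the modes. -/
lemma eq_zero_of_loopRep_add_smul {t : LieAlgebra.loopAlgebra ℂ ℤ (Sl ℓ)} {c : ℂ}
    (h : loopRep ℓ t + c • (1 : Module.End ℂ (Space ℓ)) = 0) : loopRep ℓ t = 0 ∧ c = 0 := by
  have h1 := congrArg (fun T : Module.End ℂ (Space ℓ) => constCoeff 0 (T (vac ℓ))) h
  simp only [LinearMap.add_apply, LinearMap.smul_apply, Module.End.one_apply, map_add, map_smul,
    constCoeff_loopRep_vac, LinearMap.zero_apply, map_zero, zero_add] at h1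
  have h2 : constCoeff 0 (vac ℓ) = 1 := by
    unfold vac expVec
    rw [constCoeff_single, if_pos rfl, MvPolynomial.coeff_zero_one]
  rw [h2, smul_eq_mul, mul_one] at h1
  rw [h1, zero_smul, add_zero] at h
  exact ⟨h, h1⟩

lemma cocycleForm_apply_single (t : LieAlgebra.loopAlgebra ℂ ℤ (Sl ℓ)) (n : ℤ) (Z : Sl ℓ) :
    cocycleForm ℓ t (AddMonoidAlgebra.single (-n) (1 : ℂ) ⊗ₜ[ℂ] Z) =
      (n : ℂ) * Matrix.trace ((LieAlgebra.LoopAlgebra.toFinsupp ℂ ℤ (Sl ℓ) t n).1 * Z.1) := by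
  induction t using loop_induction with
  | zero => simp
  | add s t hs ht =>
    rw [map_add, LinearMap.add_apply, hs, ht, map_add, Finsupp.add_apply, ← mul_add,
      ← Matrix.trace_add, ← add_mul]
    rfl
  | single m X =>
    rw [cocycleForm_single, LieAlgebra.LoopAlgebra.toFinsupp_single_tmul, neg_neg]
    by_cases h : m = n
    · subst h
      simp
    · simp [h]

lemma toFinsupp_lie_single (t : LieAlgebra.loopAlgebra ℂ ℤ (Sl ℓ)) (m n : ℤ) (Z : Sl ℓ) :
    LieAlgebra.LoopAlgebra.toFinsupp ℂ ℤ (Sl ℓ) 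
      (loopBracket ℓ t (AddMonoidAlgebra.single n (1 : ℂ) ⊗ₜ[ℂ] Z)) (m + n) =
        ⁅LieAlgebra.LoopAlgebra.toFinsupp ℂ ℤ (Sl ℓ) t m, Z⁆ := by
  induction t using loop_induction with
  | zero => simp only [map_zero, LinearMap.zero_apply, Finsupp.zero_apply, zero_lie]
  | add s t hs ht =>
    rw [map_add (loopBracket ℓ), LinearMap.add_apply,
      map_add (LieAlgebra.LoopAlgebra.toFinsupp ℂ ℤ (Sl ℓ)), Finsupp.add_apply, hs, ht,
      map_add (LieAlgebra.LoopAlgebra.toFinsupp ℂ ℤ (Sl ℓ)), Finsupp.add_apply, add_lie]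
  | single k X =>
    rw [loopBracket_single,
      LieAlgebra.LoopAlgebra.toFinsupp_single_tmul, LieAlgebra.LoopAlgebra.toFinsupp_single_tmul]
    by_cases h : k = m
    · subst h
      simp
    · simp [h]

open scoped ComplexOrder in
lemma sl_eq_zero_of_trace (X : Sl ℓ) (h : ∀ Z : Sl ℓ, Matrix.trace (X.1 * Z.1) = 0) : X = 0 := by
  have hX : Matrix.trace X.1 = 0 := X.2
  have hZ : Matrix.trace (X.1.conjTranspose) = 0 := by
    rw [Matrix.trace_conjTranspose, hX, star_zero]
  exact Subtype.ext (Matrix.trace_mul_conjTranspose_self_eq_zero_iff.1 (h ⟨_, hZ⟩))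

lemma sl_eq_zero_of_lie (X : Sl ℓ) (h : ∀ Z : Sl ℓ, ⁅X, Z⁆ = 0) : X = 0 := by
  have hX : Matrix.trace X.1 = 0 := X.2
  obtain ⟨c, hc⟩ : X.1 ∈ Set.range (Matrix.scalar (Fin ℓ)) := by
    rw [Matrix.mem_range_scalar_iff_commute_single]
    intro i j hij
    have h1 := congrArg Subtype.val
      (h ⟨Matrix.single i j 1, Matrix.trace_single_eq_of_ne _ _ _ hij⟩)
    rw [LieAlgebra.SpecialLinear.sl_bracket] at h1
    exact (sub_eq_zero.1 h1).symm
  refine Subtype.ext (Matrix.ext fun i j => ?_)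
  have hℓ : (ℓ : ℂ) ≠ 0 := by exact_mod_cast i.pos.ne'
  rw [← hc] at hX ⊢
  rw [Matrix.scalar_apply, Matrix.trace_diagonal, Finset.sum_const, Finset.card_univ,
    Fintype.card_fin, nsmul_eq_mul] at hX
  rw [(mul_eq_zero.1 hX).resolve_left hℓ]
  simp

/-- The kernel of `loopRep` is an ideal contained in the radical of the cocycle; as the trace form
of `𝔰𝔩_ℓ` is nondegenerate, its elements are concentrated in degree zero, and since brackets with
degree one are again of this kind, they are central. -/
lemma loopRep_injective : Function.Injective (loopRep ℓ) := by
  have key : ∀ t, loopRep ℓ t = 0 → ∀ s,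
      loopRep ℓ (loopBracket ℓ t s) = 0 ∧ cocycleForm ℓ t s = 0 := by
    intro t ht s
    refine eq_zero_of_loopRep_add_smul ?_
    rw [← comm_loopRep, ht]
    exact comm_eq_zero_symm (comm_zero _)
  -- Pairing with degree `-m` detects the component of degree `m ≠ 0`.
  have hne : ∀ t, loopRep ℓ t = 0 → ∀ m : ℤ, m ≠ 0 →
      LieAlgebra.LoopAlgebra.toFinsupp ℂ ℤ (Sl ℓ) t m = 0 := by
    intro t ht m hm
    refine sl_eq_zero_of_trace _ fun Z => ?_
    have h1 := (key t ht (AddMonoidAlgebra.single (-m) (1 : ℂ) ⊗ₜ[ℂ] Z)).2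
    rw [cocycleForm_apply_single] at h1
    exact (mul_eq_zero.1 h1).resolve_left (by exact_mod_cast hm)
  refine (injective_iff_map_eq_zero _).2 fun t ht => ?_
  refine (LieAlgebra.LoopAlgebra.toFinsupp ℂ ℤ (Sl ℓ)).map_eq_zero_iff.1 (Finsupp.ext fun m => ?_)
  by_cases hm : m = 0
  · subst hm
    -- `[X, Z]` is the component of degree one of the bracket with `Z s`, which is in the kernel.
    refine sl_eq_zero_of_lie _ fun Z => ?_
    rw [← toFinsupp_lie_single t 0 1 Z]
    exact hne _ (key t ht _).1 _ (by norm_num)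
  · exact hne t ht m hm

lemma affineRep_injective : Function.Injective (affineRep ℓ) := by
  refine (injective_iff_map_eq_zero _).2 fun x hx => ?_
  obtain ⟨h1, h2⟩ := eq_zero_of_loopRep_add_smul hx
  have h3 : ((LieAlgebra.ofProd (affineCocycle ℓ)).symm x).1 = 0 :=
    (injective_iff_map_eq_zero _).1 loopRep_injective _ h1
  have h4 : ((LieAlgebra.ofProd (affineCocycle ℓ)).symm x).2 = 0 :=
    (LinearEquiv.map_eq_zero_iff _).1 h2
  exact (LieAlgebra.ofProd (affineCocycle ℓ)).symm.injective (Prod.ext h3 h4)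

lemma glMode_coeffMatrix (a : slSpace ℓ) (m : ℤ) :
    glMode m (coeffMatrix ℓ (a : Space ℓ)) = mode (a : Space ℓ) m := by
  rw [glMode_apply, matrixState_coeffMatrix a.2]

lemma range_affineRep :
    LinearMap.range (affineRep ℓ : AffineSl ℓ →ₗ[ℂ] Module.End ℂ (Space ℓ)) =
      Submodule.span ℂ
        ({T | ∃ (a : slSpace ℓ) (m : ℤ), T = mode (a : Space ℓ) m} ∪ {1}) := by
  refine le_antisymm ?_ (Submodule.span_le.2 ?_)
  · rintro _ ⟨x, rfl⟩
    have h1 : ∀ t, loopRep ℓ t ∈ Submodule.span ℂ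
        ({T | ∃ (a : slSpace ℓ) (m : ℤ), T = mode (a : Space ℓ) m} ∪ {1}) := by
      intro t
      induction t using loop_induction with
      | zero => rw [map_zero]; exact zero_mem _
      | add s t hs ht => rw [map_add]; exact add_mem hs ht
      | single m X =>
        rw [loopRep_single]
        exact Submodule.subset_span (Or.inl ⟨(rho ℓ).symm X, m, rfl⟩)
    exact add_mem (h1 _) (Submodule.smul_mem _ _ (Submodule.subset_span (Or.inr rfl)))
  · rintro _ (⟨a, m, rfl⟩ | rfl)
    · exact ⟨loopElt (rho ℓ a) m, (affineRep_loopElt _ _).trans (glMode_coeffMatrix a m)⟩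
    · exact ⟨centralElt ℓ, affineRep_centralElt⟩

end LatticeVA

theorem mainTheorem9 (ℓ : ℕ) :
    (∀ (a b : LatticeVA.slSpace ℓ) (m n : ℤ),
      ⁅LatticeVA.mode (a : LatticeVA.Space ℓ) m, LatticeVA.mode (b : LatticeVA.Space ℓ) n⁆ =
        LatticeVA.mode (LatticeVA.stateBracket (a : LatticeVA.Space ℓ) b) (m + n) +
          (if m = -n then (m : ℂ) * LatticeVA.slForm a b else 0) •
            (1 : Module.End ℂ (LatticeVA.Space ℓ))) ∧
    ∃ φ : LatticeVA.AffineSl ℓ →ₗ⁅ℂ⁆ Module.End ℂ (LatticeVA.Space ℓ),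
      (∀ (a : LatticeVA.slSpace ℓ) (m : ℤ),
        φ (LatticeVA.loopElt (LatticeVA.rho ℓ a) m) = LatticeVA.mode (a : LatticeVA.Space ℓ) m) ∧
      φ (LatticeVA.centralElt ℓ) = 1 ∧
      Function.Injective φ ∧
      LinearMap.range (φ : LatticeVA.AffineSl ℓ →ₗ[ℂ] Module.End ℂ (LatticeVA.Space ℓ)) =
        Submodule.span ℂ
          ({T | ∃ (a : LatticeVA.slSpace ℓ) (m : ℤ), T = LatticeVA.mode (a : LatticeVA.Space ℓ) m} ∪
            {1}) := by
  refine ⟨fun a b m n => ?_, LatticeVA.affineRep ℓ, fun a m => ?_, LatticeVA.affineRep_centralElt,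
    LatticeVA.affineRep_injective, LatticeVA.range_affineRep⟩
  · have h := LatticeVA.affineRel (LatticeVA.coeffMatrix ℓ (a : LatticeVA.Space ℓ))
      (LatticeVA.coeffMatrix ℓ (b : LatticeVA.Space ℓ)) m n
    rw [LatticeVA.glMode_coeffMatrix, LatticeVA.glMode_coeffMatrix, LatticeVA.glMode_apply,
      ← LatticeVA.stateBracket_matrixState, LatticeVA.matrixState_coeffMatrix a.2,
      LatticeVA.matrixState_coeffMatrix b.2] at h
    exact h
  · exact (LatticeVA.affineRep_loopElt _ _).trans (LatticeVA.glMode_coeffMatrix a m)
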